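/- There is a real constant $K$ with $0<K\le 5.94$ such that, for every finite simple graph $G=(V,E)$ with maximum degree $\Delta(G)$, the chromatic polynomial $$\chi_G(x)=\sum_{A\subseteq E}(-1)^{|A|}x^{\kappa(A)},$$ where $\kappa(A)$ is the number of connected components of the graph $(V,A)$, satisfies $\chi_G(x)\neq 0$ for all nonzero $x\in\mathbb{C}$ with $|x|\ge K\Delta(G)$. -/

import Mathlib

open Polynomial

/-- The number of connected components of the spanning graph `(V, A)`, for a set `A` of edges on the
finite vertex set `V`. -/
noncomputable def numComponents {V : Type*} (A : Finset (Sym2 V)) : ℕ :=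
  Nat.card (SimpleGraph.fromEdgeSet (A : Set (Sym2 V))).ConnectedComponent

/-- The chromatic polynomial `∑_{A ⊆ E} (-1)^|A| X^κ(A)` of a finite simple graph `G = (V, E)`,
where `κ(A)` is the number of connected components of `(V, A)`. -/
noncomputable def chromaticPolynomial {V : Type*} (G : SimpleGraph V) [Fintype G.edgeSet] : ℤ[X] :=
  ∑ A ∈ G.edgeFinset.powerset, (-1) ^ A.card * X ^ numComponents A

/-! Grouping edge sets by the vertex partition into components turns `χ_G(x)` into a sum over
partitions of `V` with weight `x · connWeight G B` on each block `B`. Put `z = -1/x` and `t =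
treeWeight G`. After dividing by `x^|V|` the block weight is `z^(|B|-1) t(B)`; call the resulting
sum over partitions of `S` `F(S)`. Here `t(B) ≥ 0` (by Whitney it counts spanning trees without
broken circuits, but only the recursion `treeWeight_insert` is used: deleting a vertex `u` leaves
blocks that all meet its neighbourhood).

The heart is the inductive estimate `|F(S \ B)| ≤ (3/2)^|B| |F(S)|` (`deletionBound`). Taking `B = S
= V` gives `1 ≤ (3/2)^|V| |F(V)|`, so there is no zero.

For one new vertex `u` with neighbours `N` in `S`, the recursion gives `F(S ∪ {u}) = Q_N(S)`, where
each block meeting `N` gains a factor `1 + z` (`adjoinSum_insert_vertex`). Were all neighbours in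
different blocks, this would be `(1 + z)^|N| F(S)`. The error comes from blocks containing two
neighbours (`norm_adjoinSum_sub_le`). By the induction hypothesis, removing a block costs
`(3/2)^|B|`, so the error is controlled by positive tree sums with weight `ζ = (3/2)|z|` per vertex.
These obey the recursions of a rooted tree with at most `Δ` branches and are bounded by any `β` with
`ζ (1 + β)^Δ ≤ β` (`pairSum_self_le`, `sum_pairSum_le`). With `Δ|z| ≤ 1/5.94` the main term beats
the error by enough to reproduce the ratio `3/2` (`norm_le_norm_insert`). -/

section BlockSum

/-! ### Sums over set partitions and their algebra. -/

variable {V R : Type*} [DecidableEq V] [CommRing R]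

/-- The sum over all partitions of `S` of the product of `φ` over the blocks, computed by
splitting off the block of some element of `S`. -/
noncomputable def blockSum (φ : Finset V → R) (S : Finset V) : R :=
  if h : S.Nonempty then
    ∑ B ∈ (S.powerset.filter fun B => h.choose ∈ B).attach, φ B.1 * blockSum φ (S \ B.1)
  else 1
termination_by S.card
decreasing_by
  have hB := Finset.mem_filter.1 B.2
  exact Finset.card_lt_card (Finset.sdiff_ssubset (Finset.mem_powerset.1 hB.1) ⟨_, hB.2⟩)

@[simp] lemma blockSum_empty (φ : Finset V → R) : blockSum φ ∅ = 1 := by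
  rw [blockSum]; simp

lemma exists_blockSum_eq (φ : Finset V → R) {S : Finset V} (h : S.Nonempty) :
    ∃ v ∈ S, blockSum φ S =
      ∑ B ∈ S.powerset.filter (fun B => v ∈ B), φ B * blockSum φ (S \ B) := by
  refine ⟨h.choose, h.choose_spec, ?_⟩
  rw [blockSum, dif_pos h]
  exact Finset.sum_attach (S.powerset.filter fun B => h.choose ∈ B)
    (fun B => φ B * blockSum φ (S \ B))

/-- Splitting the sum over the blocks of `v` according to whether they contain `w`. -/
lemma blockSum_split (φ : Finset V → R) {S : Finset V} (v w : V)
    (ih : ∀ B ⊆ S, v ∈ B → w ∉ B → blockSum φ (S \ B) =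
      ∑ C ∈ (S \ B).powerset.filter (fun C => w ∈ C), φ C * blockSum φ ((S \ B) \ C)) :
    ∑ B ∈ S.powerset.filter (fun B => v ∈ B), φ B * blockSum φ (S \ B) =
      ∑ B ∈ S.powerset.filter (fun B => v ∈ B ∧ w ∈ B), φ B * blockSum φ (S \ B) +
      ∑ p ∈ (S.powerset ×ˢ S.powerset).filter
        (fun p => (v ∈ p.1 ∧ w ∈ p.2) ∧ Disjoint p.1 p.2),
        φ p.1 * φ p.2 * blockSum φ (S \ (p.1 ∪ p.2)) := by
  rw [← Finset.sum_filter_add_sum_filter_not _ (fun B => w ∈ B), Finset.filter_filter,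
    Finset.filter_filter]
  congr 1
  have : ∀ B ∈ S.powerset.filter (fun B => v ∈ B ∧ w ∉ B), φ B * blockSum φ (S \ B) =
      ∑ C ∈ (S \ B).powerset.filter (fun C => w ∈ C),
        φ B * φ C * blockSum φ (S \ (B ∪ C)) := by
    intro B hB
    simp only [Finset.mem_filter, Finset.mem_powerset] at hB
    rw [ih B hB.1 hB.2.1 hB.2.2, Finset.mul_sum]
    refine Finset.sum_congr rfl fun C _ => ?_
    rw [mul_assoc, sdiff_sdiff, Finset.sup_eq_union]
  rw [Finset.sum_congr rfl this, Finset.sum_sigma']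
  refine Finset.sum_nbij' (fun p => (p.1, p.2)) (fun p => ⟨p.1, p.2⟩) ?_ ?_ ?_ ?_ ?_
  · rintro ⟨B, C⟩ h
    simp only [Finset.mem_sigma, Finset.mem_filter, Finset.mem_powerset, Finset.mem_product,
      Finset.subset_sdiff] at h ⊢
    exact ⟨⟨h.1.1, h.2.1.1⟩, ⟨h.1.2.1, h.2.2⟩, h.2.1.2.symm⟩
  · rintro ⟨B, C⟩ h
    simp only [Finset.mem_sigma, Finset.mem_filter, Finset.mem_powerset, Finset.mem_product,
      Finset.subset_sdiff] at h ⊢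
    exact ⟨⟨h.1.1, h.2.1.1, fun hwB => Finset.disjoint_left.1 h.2.2 hwB h.2.1.2⟩,
      ⟨h.1.2, h.2.2.symm⟩, h.2.1.2⟩
  · intros; rfl
  · intros; rfl
  · intros; rfl

/-- The block sum may be expanded along the block of any element. -/
lemma blockSum_eq (φ : Finset V → R) (S : Finset V) (v : V) (hv : v ∈ S) :
    blockSum φ S = ∑ B ∈ S.powerset.filter (fun B => v ∈ B), φ B * blockSum φ (S \ B) := by
  induction S using Finset.strongInduction generalizing v with
  | H S ih =>
  obtain ⟨w, hw, h⟩ := exists_blockSum_eq φ ⟨v, hv⟩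
  -- Expanding at `v` and then at `w`, or in the other order, yields the same terms: one block
  -- containing both, or an ordered pair of disjoint blocks.
  have key : ∀ a ∈ S, ∀ b ∈ S, ∀ B ⊆ S, a ∈ B → b ∉ B → blockSum φ (S \ B) =
      ∑ C ∈ (S \ B).powerset.filter (fun C => b ∈ C), φ C * blockSum φ ((S \ B) \ C) :=
    fun a _ b hb B hB haB hbB =>
      ih _ (Finset.sdiff_ssubset hB ⟨a, haB⟩) b (Finset.mem_sdiff.2 ⟨hb, hbB⟩)
  rw [h, blockSum_split φ w v (key w hw v hv), blockSum_split φ v w (key v hv w hw)]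
  congr 1
  · simp only [and_comm]
  · refine Finset.sum_nbij' Prod.swap Prod.swap ?_ ?_ ?_ ?_ ?_
    · rintro ⟨B, C⟩ h
      simp only [Finset.mem_filter, Finset.mem_product, Prod.swap] at h ⊢
      exact ⟨h.1.symm, h.2.1.symm, h.2.2.symm⟩
    · rintro ⟨B, C⟩ h
      simp only [Finset.mem_filter, Finset.mem_product, Prod.swap] at h ⊢
      exact ⟨h.1.symm, h.2.1.symm, h.2.2.symm⟩
    · intros; rfl
    · intros; rfl
    · rintro ⟨B, C⟩ _
      simp only [Prod.swap]
      rw [Finset.union_comm, mul_comm (φ B)]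

lemma blockSum_congr {φ ψ : Finset V → R} {S : Finset V}
    (h : ∀ B ⊆ S, B.Nonempty → φ B = ψ B) : blockSum φ S = blockSum ψ S := by
  induction S using Finset.strongInduction with
  | H S ih =>
  rcases S.eq_empty_or_nonempty with rfl | ⟨v, hv⟩
  · simp
  rw [blockSum_eq φ S v hv, blockSum_eq ψ S v hv]
  refine Finset.sum_congr rfl fun B hB => ?_
  simp only [Finset.mem_filter, Finset.mem_powerset] at hB
  rw [h B hB.1 ⟨v, hB.2⟩, ih _ (Finset.sdiff_ssubset hB.1 ⟨v, hB.2⟩)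
    fun C hC => h C (hC.trans Finset.sdiff_subset)]

lemma blockSum_pow_card_mul (φ : Finset V → R) (c : R) (S : Finset V) :
    blockSum (fun B => c ^ B.card * φ B) S = c ^ S.card * blockSum φ S := by
  induction S using Finset.strongInduction with
  | H S ih =>
  rcases S.eq_empty_or_nonempty with rfl | ⟨v, hv⟩
  · simp
  rw [blockSum_eq _ S v hv, blockSum_eq φ S v hv, Finset.mul_sum]
  refine Finset.sum_congr rfl fun B hB => ?_
  simp only [Finset.mem_filter, Finset.mem_powerset] at hB
  rw [ih _ (Finset.sdiff_ssubset hB.1 ⟨v, hB.2⟩), ← Finset.card_sdiff_add_card_eq_card hB.1,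
    pow_add]
  ring

lemma blockSum_map {R' : Type*} [CommRing R'] (f : R →+* R') (φ : Finset V → R) (S : Finset V) :
    blockSum (fun B => f (φ B)) S = f (blockSum φ S) := by
  induction S using Finset.strongInduction with
  | H S ih =>
  rcases S.eq_empty_or_nonempty with rfl | ⟨v, hv⟩
  · simp
  rw [blockSum_eq _ S v hv, blockSum_eq φ S v hv, map_sum]
  refine Finset.sum_congr rfl fun B hB => ?_
  simp only [Finset.mem_filter, Finset.mem_powerset] at hB
  rw [ih _ (Finset.sdiff_ssubset hB.1 ⟨v, hB.2⟩), map_mul]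

lemma blockSum_nonneg {φ : Finset V → ℝ} {S : Finset V}
    (h : ∀ B ⊆ S, B.Nonempty → 0 ≤ φ B) : 0 ≤ blockSum φ S := by
  induction S using Finset.strongInduction with
  | H S ih =>
  rcases S.eq_empty_or_nonempty with rfl | ⟨v, hv⟩
  · simp
  rw [blockSum_eq _ S v hv]
  refine Finset.sum_nonneg fun B hB => ?_
  simp only [Finset.mem_filter, Finset.mem_powerset] at hB
  exact mul_nonneg (h B hB.1 ⟨v, hB.2⟩) (ih _ (Finset.sdiff_ssubset hB.1 ⟨v, hB.2⟩)
    fun C hC => h C (hC.trans Finset.sdiff_subset))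

/-- Reordering a sum over pairs `B ⊆ D ⊆ S` with `v ∈ B` as a sum over `B` and `D \ B`. -/
lemma sum_powerset_pointed (S : Finset V) (v : V) (f : Finset V → Finset V → R) :
    ∑ D ∈ S.powerset.filter (fun D => v ∈ D),
      ∑ B ∈ D.powerset.filter (fun B => v ∈ B), f B (D \ B) =
    ∑ B ∈ S.powerset.filter (fun B => v ∈ B), ∑ D ∈ (S \ B).powerset, f B D := by
  rw [Finset.sum_sigma', Finset.sum_sigma']
  refine Finset.sum_nbij' (fun p => ⟨p.2, p.1 \ p.2⟩) (fun p => ⟨p.1 ∪ p.2, p.1⟩) ?_ ?_ ?_ ?_ ?_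
  · rintro ⟨D, B⟩ h
    simp only [Finset.mem_sigma, Finset.mem_filter, Finset.mem_powerset] at h ⊢
    exact ⟨⟨h.2.1.trans h.1.1, h.2.2⟩, Finset.sdiff_subset_sdiff h.1.1 le_rfl⟩
  · rintro ⟨B, D⟩ h
    simp only [Finset.mem_sigma, Finset.mem_filter, Finset.mem_powerset] at h ⊢
    exact ⟨⟨Finset.union_subset h.1.1 (h.2.trans Finset.sdiff_subset),
      Finset.mem_union_left _ h.1.2⟩, Finset.subset_union_left, h.1.2⟩
  · rintro ⟨D, B⟩ h
    simp only [Finset.mem_sigma, Finset.mem_filter, Finset.mem_powerset] at h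
    simp [Finset.union_sdiff_of_subset h.2.1]
  · rintro ⟨B, D⟩ h
    simp only [Finset.mem_sigma, Finset.mem_filter, Finset.mem_powerset,
      Finset.subset_sdiff] at h
    simp [Finset.union_sdiff_cancel_left h.2.2.symm]
  · intros; rfl

/-- The block sum of `φ + ψ` is the convolution of the block sums of `φ` and `ψ`. -/
lemma blockSum_add (φ ψ : Finset V → R) (S : Finset V) :
    blockSum (fun B => φ B + ψ B) S = ∑ D ∈ S.powerset, blockSum φ D * blockSum ψ (S \ D) := by
  induction S using Finset.strongInduction with
  | H S ih =>
  rcases S.eq_empty_or_nonempty with rfl | ⟨v, hv⟩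
  · simp
  have h1 : ∑ D ∈ S.powerset.filter (fun D => v ∈ D), blockSum φ D * blockSum ψ (S \ D) =
      ∑ B ∈ S.powerset.filter (fun B => v ∈ B), φ B *
        ∑ D ∈ (S \ B).powerset, blockSum φ D * blockSum ψ ((S \ B) \ D) := by
    simp only [Finset.mul_sum]
    rw [← sum_powerset_pointed S v
      (fun B D => φ B * (blockSum φ D * blockSum ψ ((S \ B) \ D)))]
    refine Finset.sum_congr rfl fun D hD => ?_
    simp only [Finset.mem_filter, Finset.mem_powerset] at hD
    rw [blockSum_eq φ D v hD.2, Finset.sum_mul]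
    refine Finset.sum_congr rfl fun B hB => ?_
    simp only [Finset.mem_filter, Finset.mem_powerset] at hB
    rw [sdiff_sdiff, Finset.sup_eq_union, Finset.union_sdiff_of_subset hB.1, mul_assoc]
  -- Here the block of `v` is a `ψ`-block; passing to complements exchanges the two factors.
  have h2 : ∑ D ∈ S.powerset.filter (fun D => v ∉ D), blockSum φ D * blockSum ψ (S \ D) =
      ∑ B ∈ S.powerset.filter (fun B => v ∈ B), ψ B *
        ∑ D ∈ (S \ B).powerset, blockSum φ D * blockSum ψ ((S \ B) \ D) := by
    have : ∀ B ∈ S.powerset.filter (fun B => v ∈ B),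
        ∑ D ∈ (S \ B).powerset, ψ B * (blockSum φ D * blockSum ψ ((S \ B) \ D)) =
        ∑ D ∈ (S \ B).powerset, ψ B * (blockSum φ ((S \ B) \ D) * blockSum ψ D) := by
      intro B _
      refine Finset.sum_nbij' (fun D => (S \ B) \ D) (fun D => (S \ B) \ D) ?_ ?_ ?_ ?_ ?_
      · intro D _; exact Finset.mem_powerset.2 Finset.sdiff_subset
      · intro D _; exact Finset.mem_powerset.2 Finset.sdiff_subset
      · intro D hD; exact Finset.sdiff_sdiff_eq_self (Finset.mem_powerset.1 hD)
      · intro D hD; exact Finset.sdiff_sdiff_eq_self (Finset.mem_powerset.1 hD)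
      · intro D hD; rw [Finset.sdiff_sdiff_eq_self (Finset.mem_powerset.1 hD)]
    simp only [Finset.mul_sum]
    rw [Finset.sum_congr rfl this, ← sum_powerset_pointed S v
      (fun B D => ψ B * (blockSum φ ((S \ B) \ D) * blockSum ψ D))]
    refine Finset.sum_nbij' (fun D => S \ D) (fun D => S \ D) ?_ ?_ ?_ ?_ ?_
    · intro D hD
      simp only [Finset.mem_filter, Finset.mem_powerset, Finset.mem_sdiff] at hD ⊢
      exact ⟨Finset.sdiff_subset, hv, hD.2⟩
    · intro D hD
      simp only [Finset.mem_filter, Finset.mem_powerset, Finset.mem_sdiff] at hD ⊢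
      exact ⟨Finset.sdiff_subset, fun h => h.2 hD.2⟩
    · intro D hD
      exact Finset.sdiff_sdiff_eq_self (Finset.mem_powerset.1 (Finset.mem_filter.1 hD).1)
    · intro D hD
      exact Finset.sdiff_sdiff_eq_self (Finset.mem_powerset.1 (Finset.mem_filter.1 hD).1)
    · intro D hD
      simp only [Finset.mem_filter, Finset.mem_powerset] at hD
      have hvD : v ∈ S \ D := Finset.mem_sdiff.2 ⟨hv, hD.2⟩
      rw [blockSum_eq ψ (S \ D) v hvD, Finset.mul_sum]
      refine Finset.sum_congr rfl fun B hB => ?_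
      simp only [Finset.mem_filter, Finset.mem_powerset] at hB
      have e : (S \ B) \ ((S \ D) \ B) = D := by
        ext a
        have hB' := @hB.1 a
        have hD' := @hD.1 a
        simp only [Finset.mem_sdiff] at hB' ⊢
        tauto
      rw [e]
      ring
  rw [blockSum_eq _ S v hv, ← Finset.sum_filter_add_sum_filter_not S.powerset (fun D => v ∈ D),
    h1, h2, ← Finset.sum_add_distrib]
  refine Finset.sum_congr rfl fun B hB => ?_
  simp only [Finset.mem_filter, Finset.mem_powerset] at hB
  rw [ih _ (Finset.sdiff_ssubset hB.1 ⟨v, hB.2⟩), add_mul]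

end BlockSum

/-! ### Connected components of edge sets and the partition form of the chromatic polynomial. -/

section Components

variable {V : Type*}

/-- A set of vertices that is closed under the edges in `A` contains the components of its
elements, and these only depend on the edges at the set. -/
lemma reachable_of_closed {A A' : Set (Sym2 V)} {X : Set V}
    (h : ∀ p ∈ X, ∀ q, s(p, q) ∈ A → s(p, q) ∈ A' ∧ q ∈ X) {a b : V} (ha : a ∈ X)
    (hab : (SimpleGraph.fromEdgeSet A).Reachable a b) :
    b ∈ X ∧ (SimpleGraph.fromEdgeSet A').Reachable a b := by
  obtain ⟨p⟩ := hab
  induction p with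
  | nil => exact ⟨ha, .rfl⟩
  | cons hadj _ ih =>
    rw [SimpleGraph.fromEdgeSet_adj] at hadj
    obtain ⟨h1, h2⟩ := h _ ha _ hadj.1
    refine ⟨(ih h2).1, SimpleGraph.Reachable.trans (SimpleGraph.Adj.reachable ?_) (ih h2).2⟩
    exact (SimpleGraph.fromEdgeSet_adj _).2 ⟨h1, hadj.2⟩

lemma reachable_fromEdgeSet_mono {A A' : Set (Sym2 V)} (h : A ⊆ A') {a b : V}
    (hab : (SimpleGraph.fromEdgeSet A).Reachable a b) :
    (SimpleGraph.fromEdgeSet A').Reachable a b :=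
  hab.mono (SimpleGraph.fromEdgeSet_mono h)

variable [Fintype V]

open Classical in
/-- The vertex set of the component of `v` in `(V, A)`. -/
noncomputable def componentOf (A : Finset (Sym2 V)) (v : V) : Finset V :=
  Finset.univ.filter fun w => (SimpleGraph.fromEdgeSet (A : Set (Sym2 V))).Reachable v w

lemma mem_componentOf {A : Finset (Sym2 V)} {v w : V} :
    w ∈ componentOf A v ↔ (SimpleGraph.fromEdgeSet (A : Set (Sym2 V))).Reachable v w := by
  simp [componentOf]

lemma self_mem_componentOf (A : Finset (Sym2 V)) (v : V) : v ∈ componentOf A v :=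
  mem_componentOf.2 .rfl

lemma componentOf_eq_iff {A : Finset (Sym2 V)} {v w : V} :
    componentOf A v = componentOf A w ↔
      (SimpleGraph.fromEdgeSet (A : Set (Sym2 V))).Reachable v w := by
  constructor
  · intro h
    exact mem_componentOf.1 (h ▸ self_mem_componentOf A w)
  · intro h
    ext x
    rw [mem_componentOf, mem_componentOf]
    exact ⟨h.symm.trans, h.trans⟩

variable [DecidableEq V]

lemma card_image_componentOf (A : Finset (Sym2 V)) :
    (Finset.univ.image (componentOf A)).card = numComponents A := by
  classical
  rw [numComponents, Nat.card_eq_fintype_card, ← Finset.card_univ]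
  symm
  refine Finset.card_nbij
    (fun c => SimpleGraph.ConnectedComponent.lift (componentOf A)
      (fun v w p _ => componentOf_eq_iff.2 ⟨p⟩) c) ?_ ?_ ?_
  · intro c _
    induction c using SimpleGraph.ConnectedComponent.ind with
    | h v => simp
  · intro c _ d _ h
    induction c using SimpleGraph.ConnectedComponent.ind with
    | h v =>
    induction d using SimpleGraph.ConnectedComponent.ind with
    | h w => exact SimpleGraph.ConnectedComponent.eq.2 (componentOf_eq_iff.1 h)
  · intro C hC
    obtain ⟨v, -, rfl⟩ := Finset.mem_image.1 hC
    exact ⟨SimpleGraph.connectedComponentMk _ v, by simp, rfl⟩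

/-- The components of `(V, A)` that meet `S`. -/
noncomputable def componentsOn (A : Finset (Sym2 V)) (S : Finset V) : Finset (Finset V) :=
  S.image (componentOf A)

variable (G : SimpleGraph V) [Fintype G.edgeSet]

open Classical in
/-- The edges of `G` with both ends in `S`. -/
noncomputable def edgesIn (S : Finset V) : Finset (Sym2 V) :=
  G.edgeFinset.filter fun e => ∀ a ∈ e, a ∈ S

variable {G}

lemma mk_mem_edgesIn {S : Finset V} {a b : V} :
    s(a, b) ∈ edgesIn G S ↔ G.Adj a b ∧ a ∈ S ∧ b ∈ S := by
  simp [edgesIn]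

lemma edgesIn_univ : edgesIn G Finset.univ = G.edgeFinset := by
  simp [edgesIn]

lemma edgesIn_mono {S T : Finset V} (h : S ⊆ T) : edgesIn G S ⊆ edgesIn G T := by
  intro e
  induction e using Sym2.ind with
  | _ a b =>
    rw [mk_mem_edgesIn, mk_mem_edgesIn]
    exact fun ⟨h1, h2, h3⟩ => ⟨h1, h h2, h h3⟩

lemma componentOf_subset {A : Finset (Sym2 V)} {S : Finset V} (hA : A ⊆ edgesIn G S) {v : V}
    (hv : v ∈ S) : componentOf A v ⊆ S := fun _ hw =>
  Finset.mem_coe.1 (reachable_of_closed (A' := (A : Set (Sym2 V))) (X := (S : Set V))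
    (fun _ _ _ hpq => ⟨hpq, (mk_mem_edgesIn.1 (hA hpq)).2.2⟩) hv (mem_componentOf.1 hw)).1

variable (G) in
open Classical in
/-- The signed count of the connected spanning subgraphs of `G[B]`. -/
noncomputable def connWeight (B : Finset V) : ℤ :=
  ∑ A ∈ (edgesIn G B).powerset.filter (fun A => ∀ v ∈ B, componentOf A v = B), (-1) ^ A.card

variable (G) in
/-- The signed sum over the edge sets `A` of `G[S]` of the product of `φ` over the components. -/
noncomputable def componentSum {R : Type*} [CommRing R] (φ : Finset V → R) (S : Finset V) : R :=
  ∑ A ∈ (edgesIn G S).powerset, (-1) ^ A.card * ∏ C ∈ componentsOn A S, φ C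

lemma disjoint_edgesIn {B D : Finset V} (h : Disjoint B D) :
    Disjoint (edgesIn G B) (edgesIn G D) := by
  rw [Finset.disjoint_left]
  intro e
  induction e using Sym2.ind with
  | _ a b =>
    rw [mk_mem_edgesIn, mk_mem_edgesIn]
    exact fun h1 h2 => Finset.disjoint_left.1 h h1.2.1 h2.2.1

lemma componentOf_union_left {B D : Finset V} (h : Disjoint B D) {A₁ A₂ : Finset (Sym2 V)}
    (h₁ : A₁ ⊆ edgesIn G B) (h₂ : A₂ ⊆ edgesIn G D) {v : V} (hv : v ∈ B) :
    componentOf (A₁ ∪ A₂) v = componentOf A₁ v := by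
  ext w
  rw [mem_componentOf, mem_componentOf]
  refine ⟨fun hw => (reachable_of_closed (X := (B : Set V)) ?_ hv hw).2,
    reachable_fromEdgeSet_mono (by simp)⟩
  intro p hp q hpq
  rcases Finset.mem_union.1 (Finset.mem_coe.1 hpq) with h' | h'
  · exact ⟨h', (mk_mem_edgesIn.1 (h₁ h')).2.2⟩
  · exact absurd (mk_mem_edgesIn.1 (h₂ h')).2.1 (Finset.disjoint_left.1 h hp)

/-- No edge of `A` leaves the component `B` of `v`, so `A` is a connected spanning edge set of `B`
together with an arbitrary edge set inside `S \ B`. This is the recursion that characterizes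
`blockSum`. -/
lemma componentSum_eq {R : Type*} [CommRing R] (φ : Finset V → R) {S : Finset V} {v : V}
    (hv : v ∈ S) : componentSum G φ S = ∑ B ∈ S.powerset.filter (fun B => v ∈ B),
      ((connWeight G B : R) * φ B) * componentSum G φ (S \ B) := by
  classical
  rw [componentSum, ← Finset.sum_fiberwise_of_maps_to (g := fun A => componentOf A v)
    (t := S.powerset.filter (fun B => v ∈ B))]
  swap
  · intro A hA
    exact Finset.mem_filter.2 ⟨Finset.mem_powerset.2
      (componentOf_subset (Finset.mem_powerset.1 hA) hv), self_mem_componentOf A v⟩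
  refine Finset.sum_congr rfl fun B hB => ?_
  simp only [Finset.mem_filter, Finset.mem_powerset] at hB
  obtain ⟨hBS, hvB⟩ := hB
  have hdisj : Disjoint B (S \ B) := Finset.disjoint_sdiff
  rw [connWeight, componentSum]
  push_cast
  rw [Finset.sum_mul, Finset.sum_mul_sum, ← Finset.sum_product']
  symm
  refine Finset.sum_nbij' (fun p => p.1 ∪ p.2)
    (fun A => (A ∩ edgesIn G B, A ∩ edgesIn G (S \ B))) ?_ ?_ ?_ ?_ ?_
  · rintro ⟨A₁, A₂⟩ h
    simp only [Finset.mem_product, Finset.mem_filter, Finset.mem_powerset] at h ⊢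
    obtain ⟨⟨h1, h2⟩, h3⟩ := h
    refine ⟨Finset.union_subset (h1.trans (edgesIn_mono hBS))
      (h3.trans (edgesIn_mono Finset.sdiff_subset)), ?_⟩
    rw [componentOf_union_left hdisj h1 h3 hvB, h2 v hvB]
  · intro A hA
    simp only [Finset.mem_product, Finset.mem_filter, Finset.mem_powerset] at hA ⊢
    refine ⟨⟨Finset.inter_subset_right, fun a ha => ?_⟩, Finset.inter_subset_right⟩
    -- As a component, `B` is closed under `A`, so restricting to the edges inside `B` keeps it
    -- connected.
    have key : ∀ p ∈ (B : Set V), ∀ q, s(p, q) ∈ (A : Set (Sym2 V)) →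
        s(p, q) ∈ ((A ∩ edgesIn G B : Finset (Sym2 V)) : Set (Sym2 V)) ∧ q ∈ (B : Set V) := by
      intro p hp q hpq
      have hadj := (mk_mem_edgesIn.1 (hA.1 (Finset.mem_coe.1 hpq))).1
      have hq : q ∈ B := by
        rw [← hA.2, mem_componentOf]
        rw [Finset.mem_coe, ← hA.2, mem_componentOf] at hp
        exact hp.trans (SimpleGraph.Adj.reachable
          ((SimpleGraph.fromEdgeSet_adj _).2 ⟨hpq, hadj.ne⟩))
      exact ⟨Finset.mem_coe.2 (Finset.mem_inter.2 ⟨hpq, mk_mem_edgesIn.2 ⟨hadj, hp, hq⟩⟩), hq⟩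
    ext w
    rw [mem_componentOf]
    have hva : (SimpleGraph.fromEdgeSet (A : Set (Sym2 V))).Reachable v a :=
      mem_componentOf.1 (hA.2 ▸ ha)
    constructor
    · intro hw
      rw [← hA.2, mem_componentOf]
      exact hva.trans (reachable_fromEdgeSet_mono (by simp) hw)
    · intro hw
      rw [← hA.2, mem_componentOf] at hw
      exact (reachable_of_closed key (Finset.mem_coe.2 ha) (hva.symm.trans hw)).2
  · rintro ⟨A₁, A₂⟩ h
    simp only [Finset.mem_product, Finset.mem_filter, Finset.mem_powerset] at h
    obtain ⟨⟨h1, h2⟩, h3⟩ := h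
    have hd := disjoint_edgesIn (G := G) hdisj
    have e1 : A₂ ∩ edgesIn G B = ∅ :=
      Finset.disjoint_iff_inter_eq_empty.1 (Finset.disjoint_of_subset_left h3 hd.symm)
    have e2 : A₁ ∩ edgesIn G (S \ B) = ∅ :=
      Finset.disjoint_iff_inter_eq_empty.1 (Finset.disjoint_of_subset_left h1 hd)
    simp only [Finset.union_inter_distrib_right, e1, e2, Finset.inter_eq_left.2 h1,
      Finset.inter_eq_left.2 h3, Finset.union_empty, Finset.empty_union]
  · intro A hA
    simp only [Finset.mem_filter, Finset.mem_powerset] at hA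
    rw [← Finset.inter_union_distrib_left, Finset.inter_eq_left]
    intro e he
    induction e using Sym2.ind with
    | _ p q =>
    obtain ⟨hadj, hp, hq⟩ := mk_mem_edgesIn.1 (hA.1 he)
    have hr : (SimpleGraph.fromEdgeSet (A : Set (Sym2 V))).Reachable p q :=
      SimpleGraph.Adj.reachable ((SimpleGraph.fromEdgeSet_adj _).2 ⟨he, hadj.ne⟩)
    have hiff : p ∈ B ↔ q ∈ B := by
      rw [← hA.2, mem_componentOf, mem_componentOf]
      exact ⟨fun h => h.trans hr, fun h => h.trans hr.symm⟩
    rw [Finset.mem_union, mk_mem_edgesIn, mk_mem_edgesIn, Finset.mem_sdiff, Finset.mem_sdiff]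
    tauto
  · rintro ⟨A₁, A₂⟩ h
    simp only [Finset.mem_product, Finset.mem_filter, Finset.mem_powerset] at h
    obtain ⟨⟨h1, h2⟩, h3⟩ := h
    have hcard : (A₁ ∪ A₂).card = A₁.card + A₂.card :=
      Finset.card_union_of_disjoint (Finset.disjoint_of_subset_left h1
        (Finset.disjoint_of_subset_right h3 (disjoint_edgesIn hdisj)))
    have hcomp : componentsOn (A₁ ∪ A₂) S = insert B (componentsOn A₂ (S \ B)) := by
      have hS : S = B ∪ S \ B := (Finset.union_sdiff_of_subset hBS).symm
      rw [componentsOn, componentsOn]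
      conv_lhs => rw [hS]
      rw [Finset.image_union, Finset.insert_eq]
      congr 1
      · rw [Finset.eq_singleton_iff_unique_mem]
        constructor
        · exact Finset.mem_image.2 ⟨v, hvB, by rw [componentOf_union_left hdisj h1 h3 hvB, h2 v hvB]⟩
        · intro C hC
          obtain ⟨w, hw, rfl⟩ := Finset.mem_image.1 hC
          rw [componentOf_union_left hdisj h1 h3 hw, h2 w hw]
      · refine Finset.image_congr fun w hw => ?_
        rw [Finset.union_comm]
        exact componentOf_union_left hdisj.symm h3 h1 hw
    have hnot : B ∉ componentsOn A₂ (S \ B) := by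
      intro hmem
      obtain ⟨w, hw, hwB⟩ := Finset.mem_image.1 hmem
      exact (Finset.mem_sdiff.1 hw).2 (hwB ▸ self_mem_componentOf A₂ w)
    simp only
    rw [hcomp, Finset.prod_insert hnot, hcard, pow_add]
    ring

lemma componentSum_eq_blockSum {R : Type*} [CommRing R] (φ : Finset V → R) (S : Finset V) :
    componentSum G φ S = blockSum (fun B => (connWeight G B : R) * φ B) S := by
  induction S using Finset.strongInduction with
  | H S ih =>
  rcases S.eq_empty_or_nonempty with rfl | ⟨v, hv⟩
  · have : edgesIn G ∅ = ∅ := by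
      refine Finset.eq_empty_of_forall_notMem fun e => ?_
      induction e using Sym2.ind with
      | _ a b => simp [mk_mem_edgesIn]
    simp [componentSum, this, componentsOn]
  rw [componentSum_eq φ hv, blockSum_eq _ S v hv]
  refine Finset.sum_congr rfl fun B hB => ?_
  simp only [Finset.mem_filter, Finset.mem_powerset] at hB
  rw [ih _ (Finset.sdiff_ssubset hB.1 ⟨v, hB.2⟩)]

lemma aeval_chromaticPolynomial (x : ℂ) :
    aeval x (chromaticPolynomial G) =
      blockSum (fun B => (connWeight G B : ℂ) * x) Finset.univ := by
  rw [← componentSum_eq_blockSum, componentSum, chromaticPolynomial, edgesIn_univ]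
  simp [componentsOn, card_image_componentOf]

end Components

/-! ### Vertex recursion and sign of the connected subgraph count. -/

section Adjoin

/-- The indicator that `B` meets `N`. -/
def meets {V : Type*} [DecidableEq V] (N B : Finset V) : ℝ := if (B ∩ N).Nonempty then 1 else 0

lemma meets_nonneg {V : Type*} [DecidableEq V] (N B : Finset V) : 0 ≤ meets N B := by
  unfold meets; split_ifs <;> norm_num

lemma sum_nonempty_powerset_neg_one_pow {V : Type*} [DecidableEq V] (N : Finset V) :
    ∑ M ∈ N.powerset, (if M.Nonempty then (-1 : ℤ) ^ M.card else 0) =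
      if N.Nonempty then -1 else 0 := by
  have h := Finset.sum_powerset_neg_one_pow_card (x := N)
  have h2 : ∀ M ∈ N.powerset, (-1 : ℤ) ^ M.card =
      (if M.Nonempty then (-1 : ℤ) ^ M.card else 0) + if M = ∅ then 1 else 0 := by
    intro M _
    rcases M.eq_empty_or_nonempty with rfl | hM
    · simp
    · simp [hM, hM.ne_empty]
  rw [Finset.sum_congr rfl h2, Finset.sum_add_distrib, Finset.sum_ite_eq'] at h
  rcases N.eq_empty_or_nonempty with rfl | hN
  · simp
  · simp only [Finset.empty_mem_powerset, if_true, hN.ne_empty, if_false] at h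
    rw [if_pos hN]
    linarith

/-- The signed sum over the subsets of `N` meeting all members of a disjoint family covering `N`
factorizes over the family. -/
lemma sum_powerset_hitting {V : Type*} [DecidableEq V] (𝒞 : Finset (Finset V)) (N : Finset V)
    (hd : (𝒞 : Set (Finset V)).PairwiseDisjoint id) (hN : ∀ v ∈ N, ∃ C ∈ 𝒞, v ∈ C) :
    ∑ M ∈ N.powerset, (if ∀ C ∈ 𝒞, (C ∩ M).Nonempty then (-1 : ℤ) ^ M.card else 0) =
      ∏ C ∈ 𝒞, if (C ∩ N).Nonempty then -1 else 0 := by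
  induction 𝒞 using Finset.induction_on generalizing N with
  | empty =>
    have : N = ∅ := Finset.eq_empty_of_forall_notMem fun v hv => by simpa using hN v hv
    simp [this]
  | insert C₀ 𝒞 hC₀ ih =>
    have hdis : ∀ C ∈ 𝒞, Disjoint C C₀ := fun C hC => by
      have := hd (Finset.mem_coe.2 (Finset.mem_insert_of_mem hC))
        (Finset.mem_coe.2 (Finset.mem_insert_self C₀ 𝒞)) (fun h => hC₀ (h ▸ hC))
      exact this
    have hsd : ∀ C ∈ 𝒞, ∀ M : Finset V, C ∩ (M \ C₀) = C ∩ M := by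
      intro C hC M
      ext a
      have : a ∈ C → a ∉ C₀ := fun h => Finset.disjoint_left.1 (hdis C hC) h
      simp only [Finset.mem_inter, Finset.mem_sdiff]
      tauto
    have hih := ih (N \ C₀)
      (hd.subset (by simp [Finset.coe_insert]))
      (fun v hv => by
        obtain ⟨C, hC, hvC⟩ := hN v (Finset.mem_sdiff.1 hv).1
        rcases Finset.mem_insert.1 hC with rfl | hC
        · exact absurd hvC (Finset.mem_sdiff.1 hv).2
        · exact ⟨C, hC, hvC⟩)
    rw [Finset.prod_insert hC₀]
    have hprod : ∏ C ∈ 𝒞, (if (C ∩ N).Nonempty then (-1 : ℤ) else 0) =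
        ∏ C ∈ 𝒞, if (C ∩ (N \ C₀)).Nonempty then -1 else 0 :=
      Finset.prod_congr rfl fun C hC => by rw [hsd C hC]
    -- The factor of `C₀` is the signed sum over nonempty subsets of `N ∩ C₀`; disjointness lets the
    -- choices inside and outside `C₀` be made independently.
    rw [hprod, ← hih, Finset.inter_comm C₀ N, ← sum_nonempty_powerset_neg_one_pow,
      Finset.sum_mul_sum, ← Finset.sum_product']
    refine Finset.sum_nbij' (fun M => (M ∩ C₀, M \ C₀)) (fun p => p.1 ∪ p.2) ?_ ?_ ?_ ?_ ?_
    · intro M hM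
      rw [Finset.mem_powerset] at hM
      simp only [Finset.mem_product, Finset.mem_powerset]
      exact ⟨Finset.inter_subset_inter_right hM, Finset.sdiff_subset_sdiff hM le_rfl⟩
    · rintro ⟨M₁, M₂⟩ h
      simp only [Finset.mem_product, Finset.mem_powerset] at h ⊢
      exact Finset.union_subset (h.1.trans Finset.inter_subset_left)
        (h.2.trans Finset.sdiff_subset)
    · intro M _
      ext a
      simp only [Finset.mem_union, Finset.mem_inter, Finset.mem_sdiff]
      tauto
    · rintro ⟨M₁, M₂⟩ h
      simp only [Finset.mem_product, Finset.mem_powerset] at h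
      refine Prod.ext ?_ ?_
      · ext a
        have h1 := @h.1 a
        have h2 := @h.2 a
        simp only [Finset.mem_union, Finset.mem_inter, Finset.mem_sdiff] at h1 h2 ⊢
        tauto
      · ext a
        have h1 := @h.1 a
        have h2 := @h.2 a
        simp only [Finset.mem_union, Finset.mem_inter, Finset.mem_sdiff] at h1 h2 ⊢
        tauto
    · intro M _
      have hc : M.card = (M ∩ C₀).card + (M \ C₀).card :=
        (Finset.card_inter_add_card_sdiff M C₀).symm
      have hiff : (∀ C ∈ insert C₀ 𝒞, (C ∩ M).Nonempty) ↔
          (M ∩ C₀).Nonempty ∧ ∀ C ∈ 𝒞, (C ∩ (M \ C₀)).Nonempty := by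
        rw [Finset.forall_mem_insert, Finset.inter_comm C₀ M]
        exact and_congr_right fun _ => forall₂_congr fun C hC => by rw [hsd C hC]
      simp only [hiff]
      rw [hc, pow_add]
      by_cases hP : (M ∩ C₀).Nonempty
      · by_cases hQ : ∀ C ∈ 𝒞, (C ∩ (M \ C₀)).Nonempty
        · rw [if_pos ⟨hP, hQ⟩, if_pos hP, if_pos hQ]
        · rw [if_neg fun h => hQ h.2, if_neg hQ, mul_zero]
      · rw [if_neg fun h => hP h.1, if_neg hP, zero_mul]

variable {V : Type*} [Fintype V] [DecidableEq V] {G : SimpleGraph V} [DecidableRel G.Adj]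

lemma pairwiseDisjoint_componentsOn (A : Finset (Sym2 V)) (S : Finset V) :
    (componentsOn A S : Set (Finset V)).PairwiseDisjoint id := by
  intro C hC C' hC' hne
  obtain ⟨v, -, rfl⟩ := Finset.mem_image.1 (Finset.mem_coe.1 hC)
  obtain ⟨w, -, rfl⟩ := Finset.mem_image.1 (Finset.mem_coe.1 hC')
  rw [Function.onFun, id, id, Finset.disjoint_left]
  intro a ha ha'
  exact hne (componentOf_eq_iff.2 ((mem_componentOf.1 ha).trans (mem_componentOf.1 ha').symm))

/-- Joining a new vertex `u` to the vertices in `M` makes the graph connected if and only if `M`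
meets all components. -/
lemma connected_adjoin_iff {u : V} {D M : Finset V} (hu : u ∉ D) (hM : M ⊆ D)
    {A : Finset (Sym2 V)} (hA : A ⊆ edgesIn G D) :
    (∀ v ∈ insert u D, componentOf (A ∪ M.image fun m => s(u, m)) v = insert u D) ↔
      ∀ C ∈ componentsOn A D, (C ∩ M).Nonempty := by
  have hmem : ∀ p q, s(p, q) ∈ A ∪ M.image (fun m => s(u, m)) →
      s(p, q) ∈ A ∨ (p = u ∧ q ∈ M) ∨ (q = u ∧ p ∈ M) := by
    intro p q h
    rcases Finset.mem_union.1 h with h | h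
    · exact Or.inl h
    · obtain ⟨m, hm, hmq⟩ := Finset.mem_image.1 h
      rcases Sym2.eq_iff.1 hmq with ⟨rfl, rfl⟩ | ⟨rfl, rfl⟩
      · exact Or.inr (Or.inl ⟨rfl, hm⟩)
      · exact Or.inr (Or.inr ⟨rfl, hm⟩)
  constructor
  · intro h C hC
    obtain ⟨a, ha, rfl⟩ := Finset.mem_image.1 hC
    by_contra hne
    rw [Finset.not_nonempty_iff_eq_empty] at hne
    have hau := mem_componentOf.1
      (h a (Finset.mem_insert_of_mem ha) ▸ Finset.mem_insert_self u D :
        u ∈ componentOf (A ∪ M.image fun m => s(u, m)) a)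
    have hsub := componentOf_subset hA ha
    -- If `M` misses the component of `a`, that component stays closed after the new edges are
    -- added, so `u` is not reachable.
    refine hu (hsub (Finset.mem_coe.1 (reachable_of_closed (A' := (A : Set (Sym2 V)))
      (X := (componentOf A a : Set V)) ?_ (self_mem_componentOf A a) hau).1))
    intro p hp q hpq
    rcases hmem p q hpq with h1 | ⟨rfl, -⟩ | ⟨-, h1⟩
    · refine ⟨h1, mem_componentOf.2 ((mem_componentOf.1 hp).trans ?_)⟩
      exact SimpleGraph.Adj.reachable
        ((SimpleGraph.fromEdgeSet_adj _).2 ⟨h1, (mk_mem_edgesIn.1 (hA h1)).1.ne⟩)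
    · exact absurd (hsub hp) hu
    · exact absurd (Finset.mem_inter.2 ⟨hp, h1⟩) (by simp [hne])
  · intro h
    have hreach : ∀ v ∈ insert u D, (SimpleGraph.fromEdgeSet
        ((A ∪ M.image fun m => s(u, m) : Finset (Sym2 V)) : Set (Sym2 V))).Reachable u v := by
      intro v hv
      rcases Finset.mem_insert.1 hv with rfl | hv
      · rfl
      obtain ⟨m, hm⟩ := h _ (Finset.mem_image_of_mem _ hv)
      obtain ⟨hm1, hm2⟩ := Finset.mem_inter.1 hm
      have h1 : (SimpleGraph.fromEdgeSet
          ((A ∪ M.image fun m => s(u, m) : Finset (Sym2 V)) : Set (Sym2 V))).Adj u m :=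
        (SimpleGraph.fromEdgeSet_adj _).2
          ⟨Finset.mem_coe.2 (Finset.mem_union_right _ (Finset.mem_image_of_mem _ hm2)),
            fun h => hu (h ▸ hM hm2)⟩
      exact h1.reachable.trans
        (reachable_fromEdgeSet_mono (by simp) (mem_componentOf.1 hm1)).symm
    intro v hv
    ext w
    rw [mem_componentOf]
    constructor
    · intro hw
      refine Finset.mem_coe.1 (reachable_of_closed (A' := Set.univ)
        (X := ((insert u D : Finset V) : Set V)) ?_ (Finset.mem_coe.2 hv) hw).1
      intro p _ q hpq
      refine ⟨Set.mem_univ _, ?_⟩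
      rw [Finset.mem_coe]
      rcases hmem p q hpq with h1 | ⟨-, h1⟩ | ⟨rfl, -⟩
      · exact Finset.mem_insert_of_mem (mk_mem_edgesIn.1 (hA h1)).2.2
      · exact Finset.mem_insert_of_mem (hM h1)
      · exact Finset.mem_insert_self _ _
    · intro hw
      exact (hreach v hv).symm.trans (hreach w hw)

/-- The signed count of connected spanning subgraphs, expanded at a vertex. -/
lemma connWeight_insert {u : V} {D : Finset V} (hu : u ∉ D) :
    connWeight G (insert u D) =
      componentSum G (fun C => if (C ∩ G.neighborFinset u).Nonempty then (-1 : ℤ) else 0) D := by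
  classical
  have hstep : ∀ A ∈ (edgesIn G D).powerset,
      (-1 : ℤ) ^ A.card * ∏ C ∈ componentsOn A D,
        (if (C ∩ G.neighborFinset u).Nonempty then (-1 : ℤ) else 0) =
      ∑ M ∈ (D ∩ G.neighborFinset u).powerset, if ∀ C ∈ componentsOn A D, (C ∩ M).Nonempty then
        (-1 : ℤ) ^ A.card * (-1 : ℤ) ^ M.card else 0 := by
    intro A hA
    have hsub : ∀ C ∈ componentsOn A D, C ⊆ D := by
      intro C hC
      obtain ⟨v, hv, rfl⟩ := Finset.mem_image.1 hC
      exact componentOf_subset (Finset.mem_powerset.1 hA) hv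
    have h1 : ∏ C ∈ componentsOn A D,
        (if (C ∩ G.neighborFinset u).Nonempty then (-1 : ℤ) else 0) =
        ∏ C ∈ componentsOn A D,
          if (C ∩ (D ∩ G.neighborFinset u)).Nonempty then (-1 : ℤ) else 0 :=
      Finset.prod_congr rfl fun C hC => by
        rw [← Finset.inter_assoc, Finset.inter_eq_left.2 (hsub C hC)]
    rw [h1, ← sum_powerset_hitting _ _ (pairwiseDisjoint_componentsOn A D)
      (fun v hv => ⟨_, Finset.mem_image_of_mem _ (Finset.mem_inter.1 hv).1,
        self_mem_componentOf A v⟩), Finset.mul_sum]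
    exact Finset.sum_congr rfl fun M _ => by rw [mul_ite, mul_zero]; congr
  rw [componentSum, Finset.sum_congr rfl hstep, ← Finset.sum_product', connWeight,
    Finset.sum_filter]
  symm
  -- An edge set on `insert u D` is its part avoiding `u` plus the set `M` of neighbours joined to
  -- `u`.
  refine Finset.sum_nbij' (fun p => p.1 ∪ p.2.image fun m => s(u, m))
    (fun A => (A.filter fun e => u ∉ e, D.filter fun m => s(u, m) ∈ A)) ?_ ?_ ?_ ?_ ?_
  · rintro ⟨A, M⟩ h
    simp only [Finset.mem_product, Finset.mem_powerset] at h ⊢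
    refine Finset.union_subset (h.1.trans (edgesIn_mono (Finset.subset_insert u D))) ?_
    intro e he
    obtain ⟨m, hm, rfl⟩ := Finset.mem_image.1 he
    obtain ⟨h1, h2⟩ := Finset.mem_inter.1 (h.2 hm)
    exact mk_mem_edgesIn.2 ⟨(G.mem_neighborFinset u m).1 h2, Finset.mem_insert_self u D,
      Finset.mem_insert_of_mem h1⟩
  · intro A hA
    simp only [Finset.mem_product, Finset.mem_powerset] at hA ⊢
    constructor
    · intro e he
      obtain ⟨he1, he2⟩ := Finset.mem_filter.1 he
      induction e using Sym2.ind with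
      | _ p q =>
      obtain ⟨h1, h2, h3⟩ := mk_mem_edgesIn.1 (hA he1)
      rw [Sym2.mem_iff, not_or] at he2
      exact mk_mem_edgesIn.2 ⟨h1, (Finset.mem_insert.1 h2).resolve_left (Ne.symm he2.1),
        (Finset.mem_insert.1 h3).resolve_left (Ne.symm he2.2)⟩
    · intro m hm
      obtain ⟨hm1, hm2⟩ := Finset.mem_filter.1 hm
      exact Finset.mem_inter.2 ⟨hm1, (G.mem_neighborFinset u m).2 (mk_mem_edgesIn.1 (hA hm2)).1⟩
  · rintro ⟨A, M⟩ h
    simp only [Finset.mem_product, Finset.mem_powerset] at h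
    have hAu : ∀ e ∈ A, u ∉ e := by
      intro e he hue
      exact hu ((Finset.mem_filter.1 (h.1 he)).2 u hue)
    refine Prod.ext ?_ ?_
    · ext e
      simp only [Finset.mem_filter, Finset.mem_union, Finset.mem_image]
      constructor
      · rintro ⟨he | ⟨m, -, rfl⟩, h2⟩
        · exact he
        · exact absurd (Sym2.mem_mk_left u m) h2
      · exact fun he => ⟨Or.inl he, hAu e he⟩
    · ext m
      simp only [Finset.mem_filter, Finset.mem_union, Finset.mem_image]
      constructor
      · rintro ⟨-, he | ⟨m', hm', he⟩⟩
        · exact absurd (Sym2.mem_mk_left u m) (hAu _ he)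
        · rwa [← Sym2.congr_right.1 he]
      · exact fun hm => ⟨(Finset.mem_inter.1 (h.2 hm)).1, Or.inr ⟨m, hm, rfl⟩⟩
  · intro A hA
    simp only [Finset.mem_powerset] at hA
    ext e
    simp only [Finset.mem_filter, Finset.mem_union, Finset.mem_image]
    constructor
    · rintro (h | ⟨m, h, rfl⟩)
      · exact h.1
      · exact h.2
    · intro he
      by_cases hue : u ∈ e
      · obtain ⟨m, rfl⟩ := hue
        obtain ⟨h1, -, h3⟩ := mk_mem_edgesIn.1 (hA he)
        exact Or.inr ⟨m, ⟨(Finset.mem_insert.1 h3).resolve_left h1.ne', he⟩, rfl⟩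
      · exact Or.inl ⟨he, hue⟩
  · rintro ⟨A, M⟩ h
    simp only [Finset.mem_product, Finset.mem_powerset] at h
    have hMD : M ⊆ D := h.2.trans Finset.inter_subset_left
    have hcard : (A ∪ M.image fun m => s(u, m)).card = A.card + M.card := by
      rw [Finset.card_union_of_disjoint, Finset.card_image_of_injective]
      · exact fun a b hab => Sym2.congr_right.1 hab
      · rw [Finset.disjoint_right]
        intro e he heA
        obtain ⟨m, -, rfl⟩ := Finset.mem_image.1 he
        exact hu (mk_mem_edgesIn.1 (h.1 heA)).2.1
    simp only [connected_adjoin_iff hu hMD h.1, hcard, pow_add]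

variable (G) in
/-- The absolute value of the signed count of connected spanning subgraphs of `G[B]`. -/
noncomputable def treeWeight (B : Finset V) : ℝ := (-1) ^ (B.card + 1) * (connWeight G B : ℝ)

/-- The global sign `(-1)^|D|` distributes over the blocks, where it combines with the factor `-1`
from `connWeight_insert`. All signs disappear, which gives `treeWeight_nonneg` by induction. -/
lemma treeWeight_insert {u : V} {D : Finset V} (hu : u ∉ D) :
    treeWeight G (insert u D) =
      blockSum (fun C => treeWeight G C * meets (G.neighborFinset u) C) D := by
  have h := congrArg (Int.castRingHom ℝ) (connWeight_insert (G := G) hu)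
  rw [componentSum_eq_blockSum, ← blockSum_map, eq_intCast] at h
  rw [treeWeight, h, Finset.card_insert_of_notMem hu, add_assoc, pow_add,
    one_add_one_eq_two, neg_one_sq, mul_one, ← blockSum_pow_card_mul]
  refine blockSum_congr fun B _ _ => ?_
  simp only [treeWeight, meets, eq_intCast]
  split_ifs <;> simp [pow_succ]

/-- Nonemptiness matters: `connWeight` of the empty set is `1`, so its `treeWeight` is `-1`. -/
lemma treeWeight_nonneg {B : Finset V} (hB : B.Nonempty) : 0 ≤ treeWeight G B := by
  induction B using Finset.strongInduction with
  | H B ih =>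
  obtain ⟨u, hu⟩ := hB
  rw [← Finset.insert_erase hu, treeWeight_insert (Finset.notMem_erase u B)]
  refine blockSum_nonneg fun C hC hCne => mul_nonneg (ih C ?_ hCne) (meets_nonneg _ _)
  exact (Finset.ssubset_of_subset_of_ssubset hC (Finset.erase_ssubset hu))

end Adjoin

/-! ### Bounds on positive tree and forest sums in terms of the maximum degree. -/

section TreeBounds

variable {V : Type*} [Fintype V] [DecidableEq V] (G : SimpleGraph V) [DecidableRel G.Adj]

/-- The weighted count of the trees in `G[S]` containing `v` and `w`. -/
noncomputable def pairSum (ζ : ℝ) (S : Finset V) (v w : V) : ℝ :=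
  ∑ B ∈ S.powerset.filter (fun B => v ∈ B ∧ w ∈ B), ζ ^ B.card * treeWeight G B

/-- The weighted count of the forests in `G[S]` all of whose components meet `N`. -/
noncomputable def forestSum (ζ : ℝ) (N S : Finset V) : ℝ :=
  ∑ D ∈ S.powerset, ζ ^ D.card * blockSum (fun C => treeWeight G C * meets N C) D

variable {G}

lemma pairSum_comm (ζ : ℝ) (S : Finset V) (v w : V) : pairSum G ζ S v w = pairSum G ζ S w v := by
  simp only [pairSum, and_comm]

lemma pairSum_nonneg {ζ : ℝ} (hζ : 0 ≤ ζ) (S : Finset V) (v w : V) : 0 ≤ pairSum G ζ S v w := by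
  refine Finset.sum_nonneg fun B hB => mul_nonneg (pow_nonneg hζ _) (treeWeight_nonneg ?_)
  exact ⟨v, (Finset.mem_filter.1 hB).2.1⟩

lemma pairSum_self (ζ : ℝ) (S : Finset V) (v : V) :
    pairSum G ζ S v v = ∑ B ∈ S.powerset.filter (fun B => v ∈ B), ζ ^ B.card * treeWeight G B := by
  simp only [pairSum, and_self]

lemma blockSum_treeWeight_meets_nonneg (N D : Finset V) :
    0 ≤ blockSum (fun C => treeWeight G C * meets N C) D :=
  blockSum_nonneg fun _ _ hC => mul_nonneg (treeWeight_nonneg hC) (meets_nonneg _ _)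

lemma forestSum_mono {ζ : ℝ} (hζ : 0 ≤ ζ) (N : Finset V) {S T : Finset V} (h : S ⊆ T) :
    forestSum G ζ N S ≤ forestSum G ζ N T :=
  Finset.sum_le_sum_of_subset_of_nonneg (Finset.powerset_mono.2 h) fun _ _ _ =>
    mul_nonneg (pow_nonneg hζ _) (blockSum_treeWeight_meets_nonneg _ _)

omit [Fintype V] in
lemma meets_insert_of_notMem {N B : Finset V} {v : V} (hv : v ∉ B) :
    meets (insert v N) B = meets N B := by
  simp only [meets, Finset.inter_insert_of_notMem hv]

omit [Fintype V] in
lemma meets_eq_one {N B : Finset V} {v : V} (hv : v ∈ B) (hN : v ∈ N) : meets N B = 1 :=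
  if_pos ⟨v, Finset.mem_inter.2 ⟨hv, hN⟩⟩

omit [Fintype V] in
lemma meets_le_one (N B : Finset V) : meets N B ≤ 1 := by
  unfold meets; split_ifs <;> norm_num

lemma forestSum_empty (ζ : ℝ) (S : Finset V) : forestSum G ζ ∅ S = 1 := by
  rw [forestSum, Finset.sum_eq_single ∅]
  · simp
  · intro D _ hD
    obtain ⟨v, hv⟩ := Finset.nonempty_iff_ne_empty.2 hD
    rw [blockSum_eq _ D v hv]
    simp [meets]
  · simp

lemma forestSum_insert_of_notMem {ζ : ℝ} {N S : Finset V} {v : V} (hv : v ∉ S) :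
    forestSum G ζ (insert v N) S = forestSum G ζ N S := by
  refine Finset.sum_congr rfl fun D hD => ?_
  congr 1
  refine blockSum_congr fun B hB _ => ?_
  rw [meets_insert_of_notMem fun h => hv (Finset.mem_powerset.1 hD (hB h))]

/-- The forests covering `w`, expanded along the component of `w`. -/
lemma forestSum_pointed (ζ : ℝ) (N S : Finset V) (w : V) :
    ∑ D ∈ S.powerset.filter (fun D => w ∈ D),
      ζ ^ D.card * blockSum (fun C => treeWeight G C * meets N C) D =
    ∑ C ∈ S.powerset.filter (fun C => w ∈ C),
      ζ ^ C.card * treeWeight G C * meets N C * forestSum G ζ N (S \ C) := by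
  simp only [forestSum, Finset.mul_sum]
  rw [← sum_powerset_pointed S w (fun C D => ζ ^ C.card * treeWeight G C * meets N C *
    (ζ ^ D.card * blockSum (fun C => treeWeight G C * meets N C) D))]
  refine Finset.sum_congr rfl fun D hD => ?_
  rw [blockSum_eq _ D w (Finset.mem_filter.1 hD).2, Finset.mul_sum]
  refine Finset.sum_congr rfl fun C hC => ?_
  simp only [Finset.mem_filter, Finset.mem_powerset] at hC
  rw [← Finset.card_sdiff_add_card_eq_card hC.1, pow_add]
  ring

/-- Either `v` is not covered, and the forest already counts for `N`; or its component splits off,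
and the other components must meet `N`. -/
lemma forestSum_insert_le {ζ : ℝ} (hζ : 0 ≤ ζ) (N S : Finset V) (v : V) :
    forestSum G ζ (insert v N) S ≤ forestSum G ζ N S * (1 + pairSum G ζ S v v) := by
  rw [mul_add, mul_one]
  conv_lhs => rw [forestSum, ← Finset.sum_filter_not_add_sum_filter _ (fun D => v ∈ D)]
  refine add_le_add ?_ ?_
  · rw [forestSum]
    refine (Finset.sum_congr rfl fun D hD => ?_).trans_le
      (Finset.sum_le_sum_of_subset_of_nonneg
        (Finset.filter_subset (fun D => v ∉ D) S.powerset) fun D _ _ =>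
        mul_nonneg (pow_nonneg hζ _) (blockSum_treeWeight_meets_nonneg N D))
    congr 1
    refine blockSum_congr fun B hB _ => ?_
    rw [meets_insert_of_notMem fun h => (Finset.mem_filter.1 hD).2 (hB h)]
  · rw [forestSum_pointed, pairSum_self, Finset.mul_sum]
    refine Finset.sum_le_sum fun C hC => ?_
    have hv := (Finset.mem_filter.1 hC).2
    rw [meets_eq_one hv (Finset.mem_insert_self v N), mul_one, mul_comm,
      forestSum_insert_of_notMem fun h => (Finset.mem_sdiff.1 h).2 hv]
    exact mul_le_mul_of_nonneg_right (forestSum_mono hζ N Finset.sdiff_subset)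
      (mul_nonneg (pow_nonneg hζ _) (treeWeight_nonneg ⟨v, hv⟩))

lemma forestSum_le_pow {ζ β : ℝ} (hζ : 0 ≤ ζ) {S : Finset V}
    (hβ : ∀ v, pairSum G ζ S v v ≤ β) (N : Finset V) :
    forestSum G ζ N S ≤ (1 + β) ^ N.card := by
  induction N using Finset.induction_on with
  | empty => simp [forestSum_empty]
  | insert v N hv ih =>
    have hτ := pairSum_nonneg (G := G) hζ S v v
    have h0 : 0 ≤ β := hτ.trans (hβ v)
    rw [Finset.card_insert_of_notMem hv, pow_succ]
    refine (forestSum_insert_le hζ N S v).trans (mul_le_mul ih ?_ ?_ (by positivity))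
    · linarith [hβ v]
    · positivity

omit [Fintype V] in
lemma sum_filter_mem_powerset_insert {S : Finset V} {v : V} (hv : v ∉ S) {R : Type*}
    [AddCommMonoid R] (f : Finset V → R) (p : Finset V → Prop) [DecidablePred p]
    (q : Finset V → Prop) [DecidablePred q] (hpq : ∀ D ⊆ S, p (insert v D) ↔ q D) :
    ∑ B ∈ (insert v S).powerset.filter (fun B => v ∈ B ∧ p B), f B =
      ∑ D ∈ S.powerset.filter q, f (insert v D) := by
  refine Finset.sum_nbij' (fun B => B.erase v) (fun D => insert v D) ?_ ?_ ?_ ?_ ?_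
  · intro B hB
    simp only [Finset.mem_filter, Finset.mem_powerset] at hB ⊢
    have hs := Finset.subset_insert_iff.1 hB.1
    exact ⟨hs, (hpq _ hs).1 (by rw [Finset.insert_erase hB.2.1]; exact hB.2.2)⟩
  · intro D hD
    simp only [Finset.mem_filter, Finset.mem_powerset] at hD ⊢
    exact ⟨Finset.insert_subset_insert v hD.1, Finset.mem_insert_self v D, (hpq D hD.1).2 hD.2⟩
  · intro B hB
    exact Finset.insert_erase (Finset.mem_filter.1 hB).2.1
  · intro D hD
    simp only [Finset.mem_filter, Finset.mem_powerset] at hD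
    exact Finset.erase_insert fun h => hv (hD.1 h)
  · intro B hB
    rw [Finset.insert_erase (Finset.mem_filter.1 hB).2.1]

/-- Deleting the root `v` from a tree leaves a forest whose components all meet its neighbourhood;
the root itself contributes `ζ`. -/
lemma pairSum_insert_self (ζ : ℝ) {S : Finset V} {v : V} (hv : v ∉ S) :
    pairSum G ζ (insert v S) v v = ζ * forestSum G ζ (G.neighborFinset v) S := by
  rw [pairSum, sum_filter_mem_powerset_insert hv _ (fun B => v ∈ B) (fun _ => True) (by simp),
    Finset.filter_true, forestSum, Finset.mul_sum]
  refine Finset.sum_congr rfl fun D hD => ?_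
  have hvD : v ∉ D := fun h => hv (Finset.mem_powerset.1 hD h)
  rw [treeWeight_insert hvD, Finset.card_insert_of_notMem hvD, pow_succ]
  ring

variable {Δ : ℕ} (hΔ : ∀ v, (G.neighborFinset v).card ≤ Δ)
include hΔ

/-- `β` is a supersolution of the rooted tree equation `τ = ζ (1 + τ)^Δ`, so it survives the
induction that deletes the root. -/
lemma pairSum_self_le {ζ β : ℝ} (hζ : 0 ≤ ζ) (hβ : 0 ≤ β) (h : ζ * (1 + β) ^ Δ ≤ β)
    (S : Finset V) (v : V) : pairSum G ζ S v v ≤ β := by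
  induction S using Finset.strongInduction generalizing v with
  | H S ih =>
  by_cases hv : v ∈ S
  · rw [← Finset.insert_erase hv, pairSum_insert_self ζ (Finset.notMem_erase v S)]
    refine le_trans (mul_le_mul_of_nonneg_left ?_ hζ) h
    exact (forestSum_le_pow hζ (ih _ (Finset.erase_ssubset hv)) _).trans
      (pow_le_pow_right₀ (by linarith) (hΔ v))
  · rw [pairSum_self, Finset.sum_eq_zero]
    · exact hβ
    · intro B hB
      simp only [Finset.mem_filter, Finset.mem_powerset] at hB
      exact absurd (hB.1 hB.2) hv

lemma forestSum_neighborFinset_le {ζ β : ℝ} (hζ : 0 ≤ ζ) (hβ : 0 ≤ β)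
    (h : ζ * (1 + β) ^ Δ ≤ β) (S : Finset V) (v : V) :
    ζ * forestSum G ζ (G.neighborFinset v) S ≤ β :=
  le_trans (mul_le_mul_of_nonneg_left
    ((forestSum_le_pow hζ (pairSum_self_le hΔ hζ hβ h S) _).trans
      (pow_le_pow_right₀ (by linarith) (hΔ v))) hζ) h

/-- After deleting `v`, the component of `w` contains some neighbour `n` of `v`, which gives the
union bound over `n`. The vertex `v` with the remaining components costs at most `β`. -/
lemma pairSum_insert_le {ζ β : ℝ} (hζ : 0 ≤ ζ) (hβ : 0 ≤ β) (h : ζ * (1 + β) ^ Δ ≤ β)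
    {S : Finset V} {v w : V} (hv : v ∉ S) (hw : w ∈ S) :
    pairSum G ζ (insert v S) v w ≤ β * ∑ n ∈ G.neighborFinset v, pairSum G ζ S n w := by
  have hvw : w ≠ v := fun e => hv (e ▸ hw)
  rw [pairSum, sum_filter_mem_powerset_insert hv _ (fun B => w ∈ B) (fun D => w ∈ D)
    (by simp [hvw])]
  have h1 : ∀ D ∈ S.powerset.filter (fun D => w ∈ D),
      ζ ^ (insert v D).card * treeWeight G (insert v D) =
      ζ * (ζ ^ D.card * blockSum (fun C => treeWeight G C * meets (G.neighborFinset v) C) D) := by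
    intro D hD
    simp only [Finset.mem_filter, Finset.mem_powerset] at hD
    have hvD : v ∉ D := fun h => hv (hD.1 h)
    rw [treeWeight_insert hvD, Finset.card_insert_of_notMem hvD, pow_succ]
    ring
  rw [Finset.sum_congr rfl h1, ← Finset.mul_sum, forestSum_pointed, Finset.mul_sum]
  have h2 : ∑ n ∈ G.neighborFinset v, pairSum G ζ S n w =
      ∑ C ∈ S.powerset.filter (fun C => w ∈ C),
        ∑ n ∈ G.neighborFinset v, if n ∈ C then ζ ^ C.card * treeWeight G C else 0 := by
    rw [Finset.sum_comm]
    refine Finset.sum_congr rfl fun n _ => ?_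
    rw [pairSum, ← Finset.sum_filter, Finset.filter_filter]
    simp only [and_comm]
  rw [h2, Finset.mul_sum]
  refine Finset.sum_le_sum fun C hC => ?_
  have hwC := (Finset.mem_filter.1 hC).2
  have ht : 0 ≤ ζ ^ C.card * treeWeight G C :=
    mul_nonneg (pow_nonneg hζ _) (treeWeight_nonneg ⟨w, hwC⟩)
  have hf := forestSum_neighborFinset_le hΔ hζ hβ h (S \ C) v
  have hnn : ∀ n ∈ G.neighborFinset v, 0 ≤ if n ∈ C then ζ ^ C.card * treeWeight G C else 0 :=
    fun n _ => by split_ifs <;> simp [ht]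
  have hm : ζ ^ C.card * treeWeight G C * meets (G.neighborFinset v) C ≤
      ∑ n ∈ G.neighborFinset v, if n ∈ C then ζ ^ C.card * treeWeight G C else 0 := by
    unfold meets
    split_ifs with hne
    · obtain ⟨n, hn⟩ := hne
      obtain ⟨hn1, hn2⟩ := Finset.mem_inter.1 hn
      refine le_trans ?_ (Finset.single_le_sum hnn hn2)
      rw [if_pos hn1, mul_one]
    · rw [mul_zero]
      exact Finset.sum_nonneg hnn
  calc _ = (ζ * forestSum G ζ (G.neighborFinset v) (S \ C)) *
        (ζ ^ C.card * treeWeight G C * meets (G.neighborFinset v) C) := by ring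
    _ ≤ _ := mul_le_mul hf hm (mul_nonneg ht (meets_nonneg _ _)) hβ

/-- The weighted count of the trees rooted at `v` with a second marked vertex. -/
lemma sum_pairSum_le {ζ β M : ℝ} (hζ : 0 ≤ ζ) (hβ : 0 ≤ β) (h : ζ * (1 + β) ^ Δ ≤ β)
    (hM : β + β * (Δ * M) ≤ M) (hM0 : 0 ≤ M) (S : Finset V) (v : V) :
    ∑ w ∈ S.erase v, pairSum G ζ S v w ≤ β * (Δ * M) ∧ ∑ w ∈ S, pairSum G ζ S v w ≤ M := by
  induction S using Finset.strongInduction generalizing v with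
  | H S ih =>
  by_cases hv : v ∈ S
  · have h1 : ∑ w ∈ S.erase v, pairSum G ζ S v w ≤ β * (Δ * M) := by
      -- The second mark moves to a neighbour's branch: at most `Δ` branches, each of total weight
      -- at most `M`. The term `w = v` adds the remaining `β`.
      calc ∑ w ∈ S.erase v, pairSum G ζ S v w
          ≤ ∑ w ∈ S.erase v, β * ∑ n ∈ G.neighborFinset v, pairSum G ζ (S.erase v) n w := by
            refine Finset.sum_le_sum fun w hw => ?_
            have := pairSum_insert_le hΔ hζ hβ h (Finset.notMem_erase v S) hw
            rwa [Finset.insert_erase hv] at this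
        _ = β * ∑ n ∈ G.neighborFinset v, ∑ w ∈ S.erase v, pairSum G ζ (S.erase v) n w := by
            rw [← Finset.mul_sum, Finset.sum_comm]
        _ ≤ β * ∑ n ∈ G.neighborFinset v, M :=
            mul_le_mul_of_nonneg_left
              (Finset.sum_le_sum fun n _ => (ih _ (Finset.erase_ssubset hv) n).2) hβ
        _ ≤ β * (Δ * M) := by
            rw [Finset.sum_const, nsmul_eq_mul]
            exact mul_le_mul_of_nonneg_left
              (mul_le_mul_of_nonneg_right (by exact_mod_cast hΔ v) hM0) hβ
    refine ⟨h1, ?_⟩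
    rw [← Finset.add_sum_erase _ _ hv]
    linarith [pairSum_self_le hΔ hζ hβ h S v]
  · have h0 : ∀ w, pairSum G ζ S v w = 0 := by
      intro w
      refine Finset.sum_eq_zero fun B hB => ?_
      simp only [Finset.mem_filter, Finset.mem_powerset] at hB
      exact absurd (hB.1 hB.2.1) hv
    simp only [h0, Finset.sum_const_zero]
    exact ⟨by positivity, hM0⟩

end TreeBounds

/-! ### Ratio estimates for the normalized polynomial and the numerical conclusion. -/

section Ratio

variable {V : Type*} [Fintype V] [DecidableEq V] (G : SimpleGraph V) [DecidableRel G.Adj]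

/-- The normalized chromatic polynomial at `x = -1 / z` of `G[S]` with a new vertex attached to
the vertices in `N ∩ S`. -/
noncomputable def adjoinSum (z : ℂ) (N S : Finset V) : ℂ :=
  blockSum (fun B => z⁻¹ * (z ^ B.card * (treeWeight G B : ℂ)) * (1 + z * (meets N B : ℂ))) S

variable {G}

lemma adjoinSum_empty_right (z : ℂ) (N : Finset V) : adjoinSum G z N ∅ = 1 := blockSum_empty _

lemma aeval_chromaticPolynomial_eq {x : ℂ} (hx : x ≠ 0) :
    aeval x (chromaticPolynomial G) =
      x ^ (Finset.univ : Finset V).card * adjoinSum G (-1 / x) ∅ Finset.univ := by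
  rw [aeval_chromaticPolynomial, adjoinSum, ← blockSum_pow_card_mul]
  refine blockSum_congr fun B _ _ => ?_
  have h : (x ^ B.card) * (-1 / x) ^ B.card = (-1) ^ B.card := by
    rw [← mul_pow]; congr 1; field_simp
  have h1 : ((-1 : ℂ) ^ B.card) * (-1) ^ B.card = 1 := by
    rw [← mul_pow]; simp
  have h2 : (-1 / x)⁻¹ = -x := by field_simp
  simp only [meets, Finset.inter_empty, Finset.not_nonempty_empty, if_false, treeWeight]
  push_cast
  rw [h2, pow_succ]
  calc (connWeight G B : ℂ) * x = ((-1 : ℂ) ^ B.card) * (-1) ^ B.card * (connWeight G B * x) := by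
        rw [h1, one_mul]
    _ = (x ^ B.card * (-1 / x) ^ B.card) * (-1) ^ B.card * (connWeight G B * x) := by rw [h]
    _ = _ := by ring

/-- Split off the block `insert u D`: by `treeWeight_insert` its weight is a block sum over `D`, and
`blockSum_add` merges this with the partition of `S \ D`. -/
lemma adjoinSum_insert_vertex {z : ℂ} (hz : z ≠ 0) {S : Finset V} {u : V} (hu : u ∉ S) :
    adjoinSum G z ∅ (insert u S) = adjoinSum G z (G.neighborFinset u) S := by
  have hF : ∀ S : Finset V, adjoinSum G z ∅ S =
      blockSum (fun B => z⁻¹ * (z ^ B.card * (treeWeight G B : ℂ))) S := fun S =>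
    blockSum_congr fun B _ _ => by simp [meets]
  have hQ : adjoinSum G z (G.neighborFinset u) S =
      blockSum (fun B => z ^ B.card *
        Complex.ofRealHom (treeWeight G B * meets (G.neighborFinset u) B) +
          z⁻¹ * (z ^ B.card * (treeWeight G B : ℂ))) S :=
    blockSum_congr fun B _ _ => by
      simp only [Complex.ofRealHom_eq_coe, Complex.ofReal_mul]
      field_simp
      ring
  rw [hQ, blockSum_add, hF, blockSum_eq _ _ u (Finset.mem_insert_self u S)]
  have hs := sum_filter_mem_powerset_insert hu
    (fun B => z⁻¹ * (z ^ B.card * (treeWeight G B : ℂ)) *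
      blockSum (fun B => z⁻¹ * (z ^ B.card * (treeWeight G B : ℂ))) (insert u S \ B))
    (fun _ => True) (fun _ => True) (by simp)
  simp only [and_true, Finset.filter_true] at hs
  rw [hs]
  refine Finset.sum_congr rfl fun D hD => ?_
  have hD' := Finset.mem_powerset.1 hD
  have huD : u ∉ D := fun h => hu (hD' h)
  have hsd : insert u S \ insert u D = S \ D := by
    ext a
    simp only [Finset.mem_sdiff, Finset.mem_insert, not_or]
    constructor
    · rintro ⟨rfl | h, h1, h2⟩
      · exact absurd rfl h1
      · exact ⟨h, h2⟩
    · rintro ⟨h1, h2⟩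
      exact ⟨Or.inr h1, fun e => hu (e ▸ h1), h2⟩
  rw [blockSum_pow_card_mul, blockSum_map, ← treeWeight_insert huD, hsd,
    Finset.card_insert_of_notMem huD, pow_succ, Complex.ofRealHom_eq_coe]
  field_simp

lemma adjoinSum_congr {z : ℂ} {N N' S : Finset V} (h : N ∩ S = N' ∩ S) :
    adjoinSum G z N S = adjoinSum G z N' S := by
  refine blockSum_congr fun B hB _ => ?_
  have : B ∩ N = B ∩ N' := by
    rw [← Finset.inter_eq_right.2 hB, Finset.inter_comm S B, Finset.inter_assoc,
      Finset.inter_assoc, Finset.inter_comm S N, Finset.inter_comm S N', h]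
  simp only [meets, this]

lemma adjoinSum_insert_of_notMem {z : ℂ} {N S : Finset V} {v : V} (hv : v ∉ S) :
    adjoinSum G z (insert v N) S = adjoinSum G z N S :=
  adjoinSum_congr (by rw [Finset.insert_inter_of_notMem hv])

lemma adjoinSum_insert_expand {z : ℂ} {N S : Finset V} {v : V} (hv : v ∈ S) :
    adjoinSum G z (insert v N) S = ∑ B ∈ S.powerset.filter (fun B => v ∈ B),
      z⁻¹ * (z ^ B.card * (treeWeight G B : ℂ)) * (1 + z) * adjoinSum G z N (S \ B) := by
  rw [adjoinSum, blockSum_eq _ S v hv]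
  refine Finset.sum_congr rfl fun B hB => ?_
  have hvB := (Finset.mem_filter.1 hB).2
  rw [meets_eq_one hvB (Finset.mem_insert_self v N), Complex.ofReal_one, mul_one]
  congr 1
  exact adjoinSum_insert_of_notMem fun h => (Finset.mem_sdiff.1 h).2 hvB

/-- Only the block of `v` can change weight, and only if it misses `N`. This form gives the crude
bound `norm_adjoinSum_le`. -/
lemma adjoinSum_insert {z : ℂ} (hz : z ≠ 0) {N S : Finset V} {v : V} (hv : v ∈ S) :
    adjoinSum G z (insert v N) S = adjoinSum G z N S +
      ∑ B ∈ S.powerset.filter (fun B => v ∈ B),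
        z ^ B.card * ((treeWeight G B * (1 - meets N B) : ℝ) : ℂ) * adjoinSum G z N (S \ B) := by
  rw [adjoinSum_insert_expand hv]
  conv_rhs => rw [adjoinSum, blockSum_eq _ S v hv, ← Finset.sum_add_distrib]
  refine Finset.sum_congr rfl fun B _ => ?_
  change _ = _ * adjoinSum G z N (S \ B) + _
  push_cast
  field_simp
  ring

/-- With the expected factor `1 + z` taken out, the correction involves only blocks containing `v`
and also meeting `N`. This form gives the sharper comparison with `(1 + z)^|N|`. -/
lemma adjoinSum_insert' {z : ℂ} (hz : z ≠ 0) {N S : Finset V} {v : V} (hv : v ∈ S) :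
    adjoinSum G z (insert v N) S = (1 + z) * (adjoinSum G z N S -
      ∑ B ∈ S.powerset.filter (fun B => v ∈ B),
        z ^ B.card * ((treeWeight G B * meets N B : ℝ) : ℂ) * adjoinSum G z N (S \ B)) := by
  rw [adjoinSum_insert_expand hv]
  conv_rhs => rw [adjoinSum, blockSum_eq _ S v hv, ← Finset.sum_sub_distrib, Finset.mul_sum]
  refine Finset.sum_congr rfl fun B _ => ?_
  change _ = _ * (_ * adjoinSum G z N (S \ B) - _)
  push_cast
  field_simp
  ring

variable (G) in
/-- Deleting vertices from `G[S]` increases the normalized chromatic polynomial by a factor of at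
most `r` per vertex. -/
def DeletionBound (z : ℂ) (r : ℝ) (S : Finset V) : Prop :=
  ∀ B ⊆ S, ‖adjoinSum G z ∅ (S \ B)‖ ≤ r ^ B.card * ‖adjoinSum G z ∅ S‖

/-- The deletion bound pays `r^|B|` for removing `B`, which turns the complex sum into a positive
tree sum with weight `r‖z‖` per vertex. -/
lemma norm_sum_block_le {z : ℂ} {r C : ℝ} {N S : Finset V} {v : V} (hC : 0 ≤ C)
    (hS : DeletionBound G z r S)
    (hN : ∀ B ⊆ S, ‖adjoinSum G z N (S \ B)‖ ≤ C * ‖adjoinSum G z ∅ (S \ B)‖)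
    {c : Finset V → ℝ} (hc : ∀ B, 0 ≤ c B) :
    ‖∑ B ∈ S.powerset.filter (fun B => v ∈ B),
        z ^ B.card * ((treeWeight G B * c B : ℝ) : ℂ) * adjoinSum G z N (S \ B)‖ ≤
      (∑ B ∈ S.powerset.filter (fun B => v ∈ B), (r * ‖z‖) ^ B.card * treeWeight G B * c B) *
        (C * ‖adjoinSum G z ∅ S‖) := by
  rw [Finset.sum_mul]
  refine (norm_sum_le _ _).trans (Finset.sum_le_sum fun B hB => ?_)
  simp only [Finset.mem_filter, Finset.mem_powerset] at hB
  have ht : 0 ≤ treeWeight G B * c B := mul_nonneg (treeWeight_nonneg ⟨v, hB.2⟩) (hc B)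
  rw [norm_mul, norm_mul, norm_pow, Complex.norm_real, Real.norm_of_nonneg ht]
  calc ‖z‖ ^ B.card * (treeWeight G B * c B) * ‖adjoinSum G z N (S \ B)‖
      ≤ ‖z‖ ^ B.card * (treeWeight G B * c B) * (C * (r ^ B.card * ‖adjoinSum G z ∅ S‖)) :=
        mul_le_mul_of_nonneg_left
          ((hN B hB.1).trans (mul_le_mul_of_nonneg_left (hS B hB.1) hC)) (by positivity)
    _ = _ := by rw [mul_pow]; ring

lemma norm_adjoinSum_le {z : ℂ} (hz : z ≠ 0) {r β : ℝ} (hr : 0 ≤ r)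
    (hβ : ∀ (S : Finset V) v, pairSum G (r * ‖z‖) S v v ≤ β) {S : Finset V}
    (hS : ∀ S' ⊆ S, DeletionBound G z r S') (N : Finset V) :
    ‖adjoinSum G z N S‖ ≤ (1 + β) ^ N.card * ‖adjoinSum G z ∅ S‖ := by
  have hζ : 0 ≤ r * ‖z‖ := by positivity
  induction N using Finset.induction_on generalizing S with
  | empty => simp
  | insert v N hvN ih =>
    have hβ0 : 0 ≤ β := (pairSum_nonneg hζ S v v).trans (hβ S v)
    rw [Finset.card_insert_of_notMem hvN]
    by_cases hv : v ∈ S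
    · have h1 := norm_sum_block_le (v := v) (c := fun B => 1 - meets N B)
        (pow_nonneg (by linarith : 0 ≤ 1 + β) N.card) (hS S le_rfl)
        (fun B _ => ih fun S' hS' => hS S' (hS'.trans Finset.sdiff_subset))
        (fun B => by linarith [meets_le_one N B])
      have h2 : ∑ B ∈ S.powerset.filter (fun B => v ∈ B),
          (r * ‖z‖) ^ B.card * treeWeight G B * (1 - meets N B) ≤ β := by
        refine le_trans (Finset.sum_le_sum fun B hB => ?_) ((pairSum_self _ S v).symm.trans_le
          (hβ S v))
        exact mul_le_of_le_one_right (mul_nonneg (pow_nonneg hζ _)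
          (treeWeight_nonneg ⟨v, (Finset.mem_filter.1 hB).2⟩)) (by linarith [meets_nonneg N B])
      rw [adjoinSum_insert hz hv]
      calc _ ≤ _ := norm_add_le _ _
        _ ≤ (1 + β) ^ N.card * ‖adjoinSum G z ∅ S‖ +
            β * ((1 + β) ^ N.card * ‖adjoinSum G z ∅ S‖) :=
          add_le_add (ih hS) (h1.trans (mul_le_mul_of_nonneg_right h2 (by positivity)))
        _ = _ := by ring
    · rw [adjoinSum_insert_of_notMem hv]
      refine (ih hS).trans (mul_le_mul_of_nonneg_right ?_ (norm_nonneg _))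
      exact pow_le_pow_right₀ (by linarith) (Nat.le_succ _)

variable (G) in
/-- The weighted count of the trees in `G[S]` with two distinct marked vertices in `N`. -/
noncomputable def markedSum (ζ : ℝ) (N S : Finset V) : ℝ :=
  ∑ v ∈ N, ∑ w ∈ N.erase v, pairSum G ζ S v w

lemma markedSum_insert (ζ : ℝ) {N S : Finset V} {v : V} (hv : v ∉ N) :
    markedSum G ζ (insert v N) S = markedSum G ζ N S + 2 * ∑ w ∈ N, pairSum G ζ S v w := by
  have h : ∀ w ∈ N, ∑ a ∈ (insert v N).erase w, pairSum G ζ S w a =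
      pairSum G ζ S v w + ∑ a ∈ N.erase w, pairSum G ζ S w a := by
    intro w hw
    rw [Finset.erase_insert_of_ne (show v ≠ w from fun e => hv (e.symm ▸ hw)), Finset.sum_insert
      (fun h => hv (Finset.mem_of_mem_erase h)), pairSum_comm]
  rw [markedSum, Finset.sum_insert hv, Finset.erase_insert hv, Finset.sum_congr rfl h,
    Finset.sum_add_distrib, markedSum]
  ring

/-- Neighbours are added one at a time; each contributes an error from the pairs it forms with
earlier ones. `markedSum` counts ordered pairs, hence the division by `2`. -/
lemma norm_adjoinSum_sub_le {z : ℂ} (hz : z ≠ 0) {r β : ℝ} (hr : 0 ≤ r) (hzβ : ‖z‖ ≤ β)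
    (hβ : ∀ (S : Finset V) v, pairSum G (r * ‖z‖) S v v ≤ β) {S : Finset V}
    (hS : ∀ S' ⊆ S, DeletionBound G z r S') {N : Finset V} (hN : N ⊆ S) :
    ‖adjoinSum G z N S - (1 + z) ^ N.card * adjoinSum G z ∅ S‖ ≤
      (1 + β) ^ N.card * (markedSum G (r * ‖z‖) N S / 2) * ‖adjoinSum G z ∅ S‖ := by
  have hζ : 0 ≤ r * ‖z‖ := by positivity
  have hβ0 : 0 ≤ β := (norm_nonneg z).trans hzβ
  induction N using Finset.induction_on with
  | empty => simp [markedSum]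
  | insert v N hvN ih =>
    have hv : v ∈ S := hN (Finset.mem_insert_self v N)
    have hih := ih ((Finset.subset_insert v N).trans hN)
    have h1 := norm_sum_block_le (v := v) (c := fun B => meets N B)
      (pow_nonneg (by linarith : 0 ≤ 1 + β) N.card) (hS S le_rfl)
      (fun B _ => norm_adjoinSum_le hz hr hβ
        (fun S' hS' => hS S' (hS'.trans Finset.sdiff_subset)) N)
      (fun B => meets_nonneg N B)
    have h2 : ∑ B ∈ S.powerset.filter (fun B => v ∈ B),
        (r * ‖z‖) ^ B.card * treeWeight G B * meets N B ≤
        ∑ w ∈ N, pairSum G (r * ‖z‖) S v w := by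
      have e : ∑ w ∈ N, pairSum G (r * ‖z‖) S v w =
          ∑ B ∈ S.powerset.filter (fun B => v ∈ B),
            ∑ w ∈ N, if w ∈ B then (r * ‖z‖) ^ B.card * treeWeight G B else 0 := by
        rw [Finset.sum_comm]
        refine Finset.sum_congr rfl fun w _ => ?_
        rw [pairSum, ← Finset.sum_filter, Finset.filter_filter]
      rw [e]
      refine Finset.sum_le_sum fun B hB => ?_
      have ht : 0 ≤ (r * ‖z‖) ^ B.card * treeWeight G B :=
        mul_nonneg (pow_nonneg hζ _) (treeWeight_nonneg ⟨v, (Finset.mem_filter.1 hB).2⟩)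
      have hnn : ∀ w ∈ N, 0 ≤ if w ∈ B then (r * ‖z‖) ^ B.card * treeWeight G B else 0 :=
        fun w _ => by split_ifs <;> simp [ht]
      unfold meets
      split_ifs with hne
      · obtain ⟨n, hn⟩ := hne
        obtain ⟨hn1, hn2⟩ := Finset.mem_inter.1 hn
        refine le_trans ?_ (Finset.single_le_sum hnn hn2)
        rw [if_pos hn1, mul_one]
      · rw [mul_zero]
        exact Finset.sum_nonneg hnn
    rw [adjoinSum_insert' hz hv, Finset.card_insert_of_notMem hvN, markedSum_insert _ hvN]
    set X := ∑ B ∈ S.powerset.filter (fun B => v ∈ B),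
      z ^ B.card * ((treeWeight G B * meets N B : ℝ) : ℂ) * adjoinSum G z N (S \ B) with hX
    set F := adjoinSum G z ∅ S
    have hz1 : ‖1 + z‖ ≤ 1 + β := (norm_add_le _ _).trans (by simpa using hzβ)
    calc ‖(1 + z) * (adjoinSum G z N S - X) - (1 + z) ^ (N.card + 1) * F‖
        = ‖1 + z‖ * ‖(adjoinSum G z N S - (1 + z) ^ N.card * F) - X‖ := by
          rw [← norm_mul]; congr 1; ring
      _ ≤ (1 + β) * ((1 + β) ^ N.card * (markedSum G (r * ‖z‖) N S / 2) * ‖F‖ +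
            (∑ w ∈ N, pairSum G (r * ‖z‖) S v w) * ((1 + β) ^ N.card * ‖F‖)) := by
          refine mul_le_mul hz1 ((norm_sub_le _ _).trans (add_le_add hih (h1.trans ?_)))
            (norm_nonneg _) (by linarith)
          exact mul_le_mul_of_nonneg_right h2 (by positivity)
      _ = _ := by ring

lemma exp_four_div_eleven_le : Real.exp (4 / 11) ≤ 1.44 := by
  -- Eleventh powers reduce the claim to `e^4 ≤ 1.44^11`.
  have h : Real.exp (4 / 11) ^ 11 ≤ (1.44 : ℝ) ^ 11 := by
    rw [← Real.exp_nat_mul]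
    have e : ((11 : ℕ) : ℝ) * (4 / 11) = ((4 : ℕ) : ℝ) * 1 := by norm_num
    rw [e, Real.exp_nat_mul]
    calc Real.exp 1 ^ 4 ≤ 2.7182818286 ^ 4 :=
          pow_le_pow_left₀ (Real.exp_pos 1).le Real.exp_one_lt_d9.le 4
      _ ≤ _ := by norm_num
  exact le_of_pow_le_pow_left₀ (by norm_num) (by norm_num) h

lemma one_sub_le_norm_one_add_pow (z : ℂ) (n : ℕ) (h : n * ‖z‖ ≤ 1) :
    1 - n * ‖z‖ ≤ ‖(1 + z) ^ n‖ := by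
  rcases Nat.eq_zero_or_pos n with rfl | hn
  · simp
  have hn1 : (1 : ℝ) ≤ n := by exact_mod_cast hn
  have hz : ‖z‖ ≤ 1 := (le_mul_of_one_le_left (norm_nonneg z) hn1).trans h
  have h1 : 1 - ‖z‖ ≤ ‖1 + z‖ := by
    have := norm_sub_norm_le (1 : ℂ) (-z)
    rwa [norm_one, norm_neg, sub_neg_eq_add] at this
  calc 1 - n * ‖z‖ = 1 + n * (-‖z‖) := by ring
    _ ≤ (1 + -‖z‖) ^ n := one_add_mul_le_pow (by linarith) n
    _ ≤ ‖1 + z‖ ^ n := pow_le_pow_left₀ (by linarith) (by linarith) n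
    _ = _ := (norm_pow _ _).symm

variable {Δ : ℕ} (hΔ : ∀ v, (G.neighborFinset v).card ≤ Δ)
include hΔ

lemma norm_le_norm_insert {z : ℂ} (hz : z ≠ 0) (hzΔ : Δ * ‖z‖ ≤ 1 / 5.94) {S : Finset V}
    (hS : ∀ S' ⊆ S, DeletionBound G z (3 / 2) S') {u : V} (hu : u ∉ S) :
    ‖adjoinSum G z ∅ S‖ ≤ 3 / 2 * ‖adjoinSum G z ∅ (insert u S)‖ := by
  have hy := norm_nonneg z
  -- With this choice `Δβ ≤ 2.16 / 5.94 = 4/11`, and `(1 + β)^Δ ≤ exp (4/11) ≤ 1.44` makes `β` a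
  -- supersolution.
  set β : ℝ := 1.44 * (3 / 2 * ‖z‖) with hβdef
  have hβ0 : 0 ≤ β := by positivity
  have hΔβ : Δ * β ≤ 4 / 11 := by
    rw [hβdef]; norm_num at hzΔ ⊢; linarith
  have hpow : (1 + β) ^ Δ ≤ 1.44 := by
    calc (1 + β) ^ Δ ≤ Real.exp β ^ Δ :=
          pow_le_pow_left₀ (by linarith) (by linarith [Real.add_one_le_exp β]) Δ
      _ = Real.exp (Δ * β) := (Real.exp_nat_mul β Δ).symm
      _ ≤ Real.exp (4 / 11) := Real.exp_le_exp.2 hΔβ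
      _ ≤ 1.44 := exp_four_div_eleven_le
  have hζ : 0 ≤ 3 / 2 * ‖z‖ := by positivity
  have hβ : 3 / 2 * ‖z‖ * (1 + β) ^ Δ ≤ β := by
    have := mul_le_mul_of_nonneg_left hpow hζ
    linarith
  have hΔβ0 : 0 ≤ Δ * β := by positivity
  set N := G.neighborFinset u ∩ S with hNdef
  have hNS : N ⊆ S := Finset.inter_subset_right
  have hNΔ : N.card ≤ Δ := (Finset.card_le_card Finset.inter_subset_left).trans (hΔ u)
  have hNΔ' : (N.card : ℝ) ≤ Δ := by exact_mod_cast hNΔ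
  -- The total `M = (11/7) β` is `β / (1 - 4/11)`, which satisfies `β + βΔM ≤ M` because `Δβ ≤
  -- 4/11`.
  have hmark : markedSum G (3 / 2 * ‖z‖) N S ≤ 16 / 77 := by
    have hv : ∀ v ∈ N, ∑ w ∈ N.erase v, pairSum G (3 / 2 * ‖z‖) S v w ≤
        β * (Δ * (11 / 7 * β)) := fun v _ =>
      (Finset.sum_le_sum_of_subset_of_nonneg (Finset.erase_subset_erase v hNS)
        fun w _ _ => pairSum_nonneg hζ S v w).trans
        (sum_pairSum_le hΔ hζ hβ0 hβ (by nlinarith) (by positivity) S v).1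
    calc markedSum G (3 / 2 * ‖z‖) N S ≤ ∑ v ∈ N, β * (Δ * (11 / 7 * β)) :=
          Finset.sum_le_sum hv
      _ = N.card * (β * (Δ * (11 / 7 * β))) := by rw [Finset.sum_const, nsmul_eq_mul]
      _ ≤ Δ * (β * (Δ * (11 / 7 * β))) := mul_le_mul_of_nonneg_right hNΔ' (by positivity)
      _ = 11 / 7 * (Δ * β) ^ 2 := by ring
      _ ≤ 11 / 7 * (4 / 11) ^ 2 := by gcongr
      _ ≤ 16 / 77 := by norm_num
  have hmark0 : 0 ≤ markedSum G (3 / 2 * ‖z‖) N S :=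
    Finset.sum_nonneg fun v _ => Finset.sum_nonneg fun w _ => pairSum_nonneg hζ S v w
  have hb : (1 + β) ^ N.card ≤ 1.44 := (pow_le_pow_right₀ (by linarith) hNΔ).trans hpow
  have herr := norm_adjoinSum_sub_le hz (by norm_num : (0 : ℝ) ≤ 3 / 2)
    (by rw [hβdef]; linarith : ‖z‖ ≤ β) (fun S v => pairSum_self_le hΔ hζ hβ0 hβ S v) hS hNS
  have hNz : N.card * ‖z‖ ≤ 1 / 5.94 := (mul_le_mul_of_nonneg_right hNΔ' hy).trans hzΔ
  have hmain := one_sub_le_norm_one_add_pow z N.card (hNz.trans (by norm_num))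
  rw [adjoinSum_insert_vertex hz hu,
    adjoinSum_congr (N := G.neighborFinset u) (N' := N) (by rw [hNdef, Finset.inter_assoc, Finset.inter_self])]
  have hc : (1 + β) ^ N.card * (markedSum G (3 / 2 * ‖z‖) N S / 2) ≤ 1.44 * (8 / 77) :=
    mul_le_mul hb (by linarith) (by linarith) (by norm_num)
  have hF := norm_nonneg (adjoinSum G z ∅ S)
  have h1 : (1 - 1 / 5.94) * ‖adjoinSum G z ∅ S‖ ≤ ‖(1 + z) ^ N.card * adjoinSum G z ∅ S‖ := by
    rw [norm_mul]
    exact mul_le_mul_of_nonneg_right (by linarith) hF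
  have h2 : ‖(1 + z) ^ N.card * adjoinSum G z ∅ S‖ ≤ ‖adjoinSum G z N S‖ +
      ‖adjoinSum G z N S - (1 + z) ^ N.card * adjoinSum G z ∅ S‖ := by
    rw [norm_sub_rev]; exact norm_le_norm_add_norm_sub' _ _
  have h3 := herr.trans (mul_le_mul_of_nonneg_right hc hF)
  -- The numbers close since `1 - 1/5.94 - 1.44 · 8/77 ≈ 0.682` exceeds `2/3`.
  linarith

/-- Deleting a first vertex of `B` costs `3/2`; the induction hypothesis for the smaller set handles
the others. -/
lemma deletionBound {z : ℂ} (hz : z ≠ 0) (hzΔ : Δ * ‖z‖ ≤ 1 / 5.94) (S : Finset V) :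
    DeletionBound G z (3 / 2) S := by
  induction S using Finset.strongInduction with
  | H S ih =>
  intro B hB
  rcases B.eq_empty_or_nonempty with rfl | ⟨u, hu⟩
  · simp
  have huS := hB hu
  have hss := Finset.erase_ssubset huS
  have h1 := norm_le_norm_insert hΔ hz hzΔ
    (fun S' hS' => ih S' (Finset.ssubset_of_subset_of_ssubset hS' hss)) (Finset.notMem_erase u S)
  have h2 := ih _ hss (B.erase u) (Finset.erase_subset_erase u hB)
  have e : S.erase u \ B.erase u = S \ B := by
    ext a
    simp only [Finset.mem_sdiff, Finset.mem_erase]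
    constructor
    · rintro ⟨⟨h1, h2⟩, h3⟩
      exact ⟨h2, fun h => h3 ⟨h1, h⟩⟩
    · rintro ⟨h1, h2⟩
      exact ⟨⟨fun e => h2 (e ▸ hu), h1⟩, fun h => h2 h.2⟩
  rw [e] at h2
  rw [Finset.insert_erase huS] at h1
  rw [← Finset.card_erase_add_one hu, pow_succ, mul_assoc]
  exact h2.trans (mul_le_mul_of_nonneg_left h1 (by positivity))

end Ratio

theorem theorem1p1 :
    ∃ K : ℝ, 0 < K ∧ K ≤ 5.94 ∧
      ∀ (V : Type*) [Fintype V] [DecidableEq V] (G : SimpleGraph V) [DecidableRel G.Adj] (x : ℂ),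
        x ≠ 0 → K * (G.maxDegree : ℝ) ≤ ‖x‖ → aeval x (chromaticPolynomial G) ≠ 0 := by
  refine ⟨5.94, by norm_num, le_rfl, fun V _ _ G _ x hx hK => ?_⟩
  have hz : -1 / x ≠ 0 := div_ne_zero (by norm_num) hx
  have hxpos : 0 < ‖x‖ := norm_pos_iff.2 hx
  have hzΔ : (G.maxDegree : ℝ) * ‖-1 / x‖ ≤ 1 / 5.94 := by
    rw [norm_div, norm_neg, norm_one, mul_one_div, div_le_div_iff₀ hxpos (by norm_num)]
    linarith
  rw [aeval_chromaticPolynomial_eq hx]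
  refine mul_ne_zero (pow_ne_zero _ hx) fun h0 => ?_
  -- Deleting every vertex leaves the empty set, where the normalized sum is `1`; a zero would give
  -- `1 ≤ 0`.
  have h := deletionBound (G := G) (fun v => G.degree_le_maxDegree v) hz hzΔ Finset.univ
    Finset.univ le_rfl
  rw [h0, sdiff_self, Finset.bot_eq_empty, adjoinSum_empty_right, norm_one, norm_zero,
    mul_zero] at h
  linarith
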